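/- **Theorem (DFO($\lambda$) for non-smooth optimization).** Let $d\ge 1$, let $\mathsf Z$ be a measurable space, $\ell:\mathbb R^d\times\mathsf Z\to\mathbb R$ a loss that is measurable in $z$, and for every $\theta\in\mathbb R^d$ let $\mathbb T_\theta$ be a Markov kernel on $\mathsf Z$ with stationary probability measure $\Pi_\theta$. Write $\|\mu-\nu\|_{TV}=\sup_A(\mu(A)-\nu(A))$ over measurable $A\subset\mathsf Z$, $$\mathcal L(\theta)=\mathbb E_{Z\sim\Pi_\theta}[\ell(\theta;Z)],\qquad \mathcal L_\delta(\theta)=\mathbb E_{w}[\mathcal L(\theta+\delta w)],\quad w\sim\mathrm{Unif}(\mathbb B^d),$$ where $\mathbb B^d$ is the unit ball and $\mathbb S^{d-1}$ the unit sphere. Suppose that there are constants $L_0,G,L_1>0$, $L_2,M\ge 0$, $\rho\in[0,1)$ such that for all $\theta_1,\theta_2,\theta\in\mathbb R^d$, $z\in\mathsf Z$ and integers $k\ge 0$: 1. (Lipschitz loss) $|\ell(\theta_1;z)-\ell(\theta_2;z)|\le L_0\|\theta_1-\theta_2\|$; 2. (bounded loss) $|\ell(\theta;z)|\le G$; 3.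 (Lipschitz distribution map) $\|\Pi_{\theta_1}-\Pi_{\theta_2}\|_{TV}\le L_1\|\theta_1-\theta_2\|$; 4. (geometric mixing) $\|\mathbb T_\theta^k(z,\cdot)-\Pi_\theta\|_{TV}\le M\rho^k$; 5. (smooth kernel) $\|\mathbb T_{\theta_1}(z,\cdot)-\mathbb T_{\theta_2}(z,\cdot)\|_{TV}\le L_2\|\theta_1-\theta_2\|$. Let $\lambda\in[0,1)$, $\eta_0>0$, $0<3\beta<\alpha<1$, $\eta_k=\eta_0(1+k)^{-\alpha}$, $\delta_k=d(1+k)^{-\beta}$, and let $\tau_k\ge 1$ be integers with $\tau_k\ge \log(1+k)/\log(1/\max\{\rho,\lambda\})$ for all $k\ge 0$ (the quotient is read as $0$ if $\rho=\lambda=0$). Let $(\theta_k)_{k\ge0}$ be generated by DFO($\lambda$): start from $(\theta_0,Z_0)$ with an arbitrary law; in epoch $k$ draw $u_k\sim\mathrm{Unif}(\mathbb S^{d-1})$ independently of the past, set $\theta_k^{(1)}=\theta_k$, $Z_k^{(0)}=Z_k$, and for $m=1,\dots,\tau_k$ draw $$Z_k^{(m)}\sim\mathbb T_{\theta_k^{(m)}+\delta_k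 u_k}\big(Z_k^{(m-1)},\cdot\big),\qquad \theta_k^{(m+1)}=\theta_k^{(m)}-\eta_k\lambda^{\tau_k-m}\,\frac{d}{\delta_k}\,\ell\big(\theta_k^{(m)}+\delta_k u_k;Z_k^{(m)}\big)\,u_k;$$ then $\theta_{k+1}=\theta_k^{(\tau_k+1)}$ and $Z_{k+1}=Z_k^{(\tau_k)}$. Then every $\mathcal L_{\delta_k}$ is differentiable, $\|\nabla\mathcal L_{\delta_k}(\theta_k)\|^2$ is integrable, and there are constants $C$ and $t_4$, depending only on $d,L_0,G,L_1,L_2,M,\rho,\lambda,\eta_0,\alpha,\beta$, such that for all integers $T\ge t_4$ $$\frac1{1+T}\sum_{k=0}^{T}\mathbb E\|\nabla\mathcal L_{\delta_k}(\theta_k)\|^2\le C\,T^{-\min\{1-\alpha,\ \alpha-3\beta\}},$$ and for all integers $T>0$ and all $\theta\in\mathbb R^d$ $$\frac1{1+T}\sum_{k=0}^{T}|\mathcal L_{\delta_k}(\theta)-\mathcal L(\theta)|\le C\,T^{-\beta}.$$ -/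

import Mathlib

open MeasureTheory ProbabilityTheory

noncomputable section

/-- The total variation distance `sup_A (μ A - ν A)`, the supremum over measurable sets `A`. -/
def tvDistance {Z : Type*} [MeasurableSpace Z] (μ ν : Measure Z) : ℝ :=
  ⨆ A : {A : Set Z // MeasurableSet A}, (μ.real A.1 - ν.real A.1)

/-- The performative risk `𝓛(θ) = 𝔼_{z ∼ Π_θ} [ℓ(θ; z)]`. -/
def performativeRisk {d : ℕ} {Z : Type*} [MeasurableSpace Z]
    (ℓ : EuclideanSpace ℝ (Fin d) → Z → ℝ) (Pi : EuclideanSpace ℝ (Fin d) → Measure Z)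
    (θ : EuclideanSpace ℝ (Fin d)) : ℝ :=
  ∫ z, ℓ θ z ∂(Pi θ)

/-- The smoothed risk `𝓛_δ(θ) = 𝔼_w [𝓛(θ + δ w)]`, with `w` uniform on the unit ball. -/
def smoothedRisk {d : ℕ} {Z : Type*} [MeasurableSpace Z]
    (ℓ : EuclideanSpace ℝ (Fin d) → Z → ℝ) (Pi : EuclideanSpace ℝ (Fin d) → Measure Z)
    (δ : ℝ) (θ : EuclideanSpace ℝ (Fin d)) : ℝ :=
  ⨍ w in Metric.closedBall (0 : EuclideanSpace ℝ (Fin d)) 1,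
    performativeRisk ℓ Pi (θ + δ • w) ∂volume

/-- The uniform distribution on the unit sphere, as a measure on the ambient space. -/
def uniformSphere (d : ℕ) : Measure (EuclideanSpace ℝ (Fin d)) :=
  Measure.map Subtype.val
    (ProbabilityTheory.cond (volume : Measure (EuclideanSpace ℝ (Fin d))).toSphere Set.univ)

/-- One inner step, from `(θ, z)`: deploy `θ + δ u`, draw `z' ∼ T_{θ + δ u}(z, ·)`, and move
to `(θ - η w g, z')` with `g = (d / δ) ℓ(θ + δ u; z') u`. This is the law of the new pair. -/
def dfoStep {d : ℕ} {Z : Type*} [MeasurableSpace Z]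
    (T : EuclideanSpace ℝ (Fin d) → Kernel Z Z) (ℓ : EuclideanSpace ℝ (Fin d) → Z → ℝ)
    (η δ w : ℝ) (u : EuclideanSpace ℝ (Fin d)) (s : EuclideanSpace ℝ (Fin d) × Z) :
    Measure (EuclideanSpace ℝ (Fin d) × Z) :=
  (T (s.1 + δ • u) s.2).map
    (fun z' => (s.1 - (η * w) • (((d : ℝ) / δ * ℓ (s.1 + δ • u) z') • u), z'))

/-- The law of `(θ_k^{(m+1)}, Z_k^{(m)})`, after `m` inner steps of an epoch of length `τ`
that starts from the pair `s` and uses the direction `u`; step `m` has weight `lam ^ (τ - m)`. -/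
def dfoInner {d : ℕ} {Z : Type*} [MeasurableSpace Z]
    (T : EuclideanSpace ℝ (Fin d) → Kernel Z Z) (ℓ : EuclideanSpace ℝ (Fin d) → Z → ℝ)
    (lam η δ : ℝ) (τ : ℕ) (u : EuclideanSpace ℝ (Fin d)) (s : EuclideanSpace ℝ (Fin d) × Z) :
    ℕ → Measure (EuclideanSpace ℝ (Fin d) × Z)
  | 0 => Measure.dirac s
  | m + 1 => (dfoInner T ℓ lam η δ τ u s m).bind (dfoStep T ℓ η δ (lam ^ (τ - (m + 1))) u)

/-- The law of the pair `(θ_k, Z_k)` at the start of epoch `k` of the algorithm, when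
`(θ_0, Z_0)` has law `μ₀`. In epoch `k` a direction is drawn uniformly from the unit sphere,
independently of the past, and `τ k` inner steps are made with it. -/
def dfoLaw {d : ℕ} {Z : Type*} [MeasurableSpace Z]
    (T : EuclideanSpace ℝ (Fin d) → Kernel Z Z) (ℓ : EuclideanSpace ℝ (Fin d) → Z → ℝ)
    (lam : ℝ) (η δ : ℕ → ℝ) (τ : ℕ → ℕ) (μ₀ : Measure (EuclideanSpace ℝ (Fin d) × Z)) :
    ℕ → Measure (EuclideanSpace ℝ (Fin d) × Z)
  | 0 => μ₀
  | k + 1 => (dfoLaw T ℓ lam η δ τ μ₀ k).bind fun s =>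
      (uniformSphere d).bind fun u => dfoInner T ℓ lam (η k) (δ k) (τ k) u s (τ k)

theorem le_tvDistance {Z : Type*} [MeasurableSpace Z] (μ ν : Measure Z)
    [IsProbabilityMeasure μ] [IsProbabilityMeasure ν] {A : Set Z} (hA : MeasurableSet A) :
    μ.real A - ν.real A ≤ tvDistance μ ν := by
  refine le_ciSup (f := fun A : {A : Set Z // MeasurableSet A} => μ.real A.1 - ν.real A.1)
    ⟨1, ?_⟩ ⟨A, hA⟩
  rintro _ ⟨B, rfl⟩
  have h1 : μ.real B.1 ≤ 1 := measureReal_le_one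
  have h2 : 0 ≤ ν.real B.1 := measureReal_nonneg
  simp only
  linarith

/-- A kernel that is Lipschitz in the parameter is jointly measurable. -/
theorem measurable_uncurry_kernel {d : ℕ} {Z : Type*} [MeasurableSpace Z]
    (T : EuclideanSpace ℝ (Fin d) → Kernel Z Z) (hT : ∀ θ, IsMarkovKernel (T θ)) (L₂ : ℝ)
    (hL : ∀ θ₁ θ₂ z, tvDistance (T θ₁ z) (T θ₂ z) ≤ L₂ * ‖θ₁ - θ₂‖) :
    Measurable fun p : EuclideanSpace ℝ (Fin d) × Z => T p.1 p.2 := by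
  refine Measure.measurable_of_measurable_coe _ fun A hA => ?_
  have hr : Measurable (Function.uncurry fun (θ : EuclideanSpace ℝ (Fin d)) (z : Z) =>
      (T θ z).real A) := by
    refine measurable_uncurry_of_continuous_of_measurable ?_ ?_
    · intro z
      refine (LipschitzWith.of_dist_le_mul (K := L₂.toNNReal) fun θ₁ θ₂ => ?_).continuous
      have h1 := (le_tvDistance (T θ₁ z) (T θ₂ z) hA).trans (hL θ₁ θ₂ z)
      have h2 := (le_tvDistance (T θ₂ z) (T θ₁ z) hA).trans (hL θ₂ θ₁ z)
      rw [norm_sub_rev] at h2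
      have h3 : L₂ * ‖θ₁ - θ₂‖ ≤ L₂.toNNReal * ‖θ₁ - θ₂‖ :=
        mul_le_mul_of_nonneg_right (Real.le_coe_toNNReal _) (norm_nonneg _)
      rw [Real.dist_eq, dist_eq_norm, abs_le]
      constructor <;> linarith
    · intro θ
      exact ((T θ).measurable_coe hA).ennreal_toReal
  have := hr.ennreal_ofReal
  convert this using 1
  ext p
  simp [Function.uncurry, measureReal_def]

/-- A loss that is Lipschitz in the parameter is jointly measurable. -/
theorem measurable_uncurry_loss {d : ℕ} {Z : Type*} [MeasurableSpace Z]
    (ℓ : EuclideanSpace ℝ (Fin d) → Z → ℝ) (hm : ∀ θ, Measurable (ℓ θ)) (L₀ : ℝ)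
    (hL : ∀ θ₁ θ₂ z, |ℓ θ₁ z - ℓ θ₂ z| ≤ L₀ * ‖θ₁ - θ₂‖) :
    Measurable (Function.uncurry ℓ) := by
  refine measurable_uncurry_of_continuous_of_measurable (fun z => ?_) hm
  refine (LipschitzWith.of_dist_le_mul (K := L₀.toNNReal) fun θ₁ θ₂ => ?_).continuous
  rw [Real.dist_eq, dist_eq_norm]
  exact (hL θ₁ θ₂ z).trans
    (mul_le_mul_of_nonneg_right (Real.le_coe_toNNReal _) (norm_nonneg _))

theorem isProbabilityMeasure_uniformSphere {d : ℕ} [NeZero d] :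
    IsProbabilityMeasure (uniformSphere d) := by
  have : Nontrivial (EuclideanSpace ℝ (Fin d)) := by
    refine Module.nontrivial_of_finrank_pos (R := ℝ) ?_
    simpa using Nat.pos_of_ne_zero (NeZero.ne d)
  have : IsProbabilityMeasure
      (ProbabilityTheory.cond (volume : Measure (EuclideanSpace ℝ (Fin d))).toSphere Set.univ) :=
    cond_isProbabilityMeasure fun h =>
      Measure.toSphere_ne_zero (volume : Measure (EuclideanSpace ℝ (Fin d)))
        (Measure.measure_univ_eq_zero.1 h)
  exact Measure.isProbabilityMeasure_map measurable_subtype_coe.aemeasurable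

theorem isProbabilityMeasure_bind_of_measurable {X Y : Type*} [MeasurableSpace X]
    [MeasurableSpace Y] (μ : Measure X) [IsProbabilityMeasure μ] (f : X → Measure Y)
    (hf : Measurable f) (h : ∀ x, IsProbabilityMeasure (f x)) :
    IsProbabilityMeasure (μ.bind f) := by
  constructor
  rw [Measure.bind_apply MeasurableSet.univ hf.aemeasurable]
  simp

theorem measurable_bind_param {W X Y : Type*} [MeasurableSpace W] [MeasurableSpace X]
    [MeasurableSpace Y] (m : W → Measure X) (hm : Measurable m)
    (h : ∀ w, IsProbabilityMeasure (m w)) (f : W → X → Measure Y)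
    (hf : Measurable (Function.uncurry f)) :
    Measurable fun w => (m w).bind (f w) := by
  let κ : Kernel W X := ⟨m, hm⟩
  have : IsMarkovKernel κ := ⟨h⟩
  refine Measure.measurable_of_measurable_coe _ fun A hA => ?_
  have e : (fun w => (m w).bind (f w) A) = fun w => ∫⁻ x, f w x A ∂(κ w) := by
    ext w
    exact Measure.bind_apply hA (hf.comp measurable_prodMk_left).aemeasurable
  rw [e]
  exact Measurable.lintegral_kernel_prod_right (κ := κ)
    (f := fun w x => f w x A) ((Measure.measurable_coe hA).comp hf)

theorem measurable_dfoStep {d : ℕ} {Z : Type*} [MeasurableSpace Z]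
    (T : EuclideanSpace ℝ (Fin d) → Kernel Z Z) (ℓ : EuclideanSpace ℝ (Fin d) → Z → ℝ)
    (hT : ∀ θ, IsMarkovKernel (T θ))
    (hTm : Measurable fun p : EuclideanSpace ℝ (Fin d) × Z => T p.1 p.2)
    (hℓ : Measurable (Function.uncurry ℓ)) (η δ w : ℝ) :
    (Measurable fun p : EuclideanSpace ℝ (Fin d) × (EuclideanSpace ℝ (Fin d) × Z) =>
      dfoStep T ℓ η δ w p.1 p.2) ∧ ∀ u s, IsProbabilityMeasure (dfoStep T ℓ η δ w u s) := by
  have hg : Measurable fun q : (EuclideanSpace ℝ (Fin d) × (EuclideanSpace ℝ (Fin d) × Z)) × Z =>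
      (q.1.2.1 - (η * w) •
        (((d : ℝ) / δ * ℓ (q.1.2.1 + δ • q.1.1) q.2) • q.1.1), q.2) := by
    have h : Measurable fun q : (EuclideanSpace ℝ (Fin d) × (EuclideanSpace ℝ (Fin d) × Z)) × Z =>
        ℓ (q.1.2.1 + δ • q.1.1) q.2 :=
      hℓ.comp (f := fun q : (EuclideanSpace ℝ (Fin d) × (EuclideanSpace ℝ (Fin d) × Z)) × Z =>
        (q.1.2.1 + δ • q.1.1, q.2)) (by fun_prop)
    fun_prop
  constructor
  · have e : (fun p : EuclideanSpace ℝ (Fin d) × (EuclideanSpace ℝ (Fin d) × Z) =>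
        dfoStep T ℓ η δ w p.1 p.2) = fun p => (T (p.2.1 + δ • p.1) p.2.2).bind
          (fun z' => Measure.dirac (p.2.1 - (η * w) •
            (((d : ℝ) / δ * ℓ (p.2.1 + δ • p.1) z') • p.1), z')) := by
      ext1 p
      rw [dfoStep]
      exact (Measure.bind_dirac_eq_map _ (hg.comp measurable_prodMk_left)).symm
    rw [e]
    refine measurable_bind_param _ ?_ (fun p => inferInstance) _ (Measure.measurable_dirac.comp hg)
    exact hTm.comp (f := fun p : EuclideanSpace ℝ (Fin d) × (EuclideanSpace ℝ (Fin d) × Z) =>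
      (p.2.1 + δ • p.1, p.2.2)) (by fun_prop)
  · intro u s
    exact Measure.isProbabilityMeasure_map
      (hg.comp (measurable_prodMk_left (x := (u, s)))).aemeasurable

theorem measurable_dfoInner {d : ℕ} {Z : Type*} [MeasurableSpace Z]
    (T : EuclideanSpace ℝ (Fin d) → Kernel Z Z) (ℓ : EuclideanSpace ℝ (Fin d) → Z → ℝ)
    (hT : ∀ θ, IsMarkovKernel (T θ))
    (hTm : Measurable fun p : EuclideanSpace ℝ (Fin d) × Z => T p.1 p.2)
    (hℓ : Measurable (Function.uncurry ℓ)) (lam η δ : ℝ) (τ m : ℕ) :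
    (Measurable fun p : EuclideanSpace ℝ (Fin d) × (EuclideanSpace ℝ (Fin d) × Z) =>
      dfoInner T ℓ lam η δ τ p.1 p.2 m) ∧
      ∀ u s, IsProbabilityMeasure (dfoInner T ℓ lam η δ τ u s m) := by
  induction m with
  | zero => exact ⟨Measure.measurable_dirac.comp measurable_snd,
      fun u s => Measure.dirac.isProbabilityMeasure⟩
  | succ m ih =>
    have hs := measurable_dfoStep T ℓ hT hTm hℓ η δ (lam ^ (τ - (m + 1)))
    constructor
    · refine measurable_bind_param _ ih.1 (fun p => ih.2 _ _) _ ?_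
      exact hs.1.comp (f := fun q : (EuclideanSpace ℝ (Fin d) ×
        (EuclideanSpace ℝ (Fin d) × Z)) × (EuclideanSpace ℝ (Fin d) × Z) => (q.1.1, q.2))
        (by fun_prop)
    · intro u s
      have := ih.2 u s
      exact isProbabilityMeasure_bind_of_measurable _ _
        (hs.1.comp measurable_prodMk_left) (hs.2 u)

/-- The laws of the iterates are genuine probability measures: the iterated integrals that
define them are taken of measurable families of probability measures. -/
theorem isProbabilityMeasure_dfoLaw {d : ℕ} (hd : 0 < d) {Z : Type*} [MeasurableSpace Z]
    (T : EuclideanSpace ℝ (Fin d) → Kernel Z Z) (ℓ : EuclideanSpace ℝ (Fin d) → Z → ℝ)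
    (hT : ∀ θ, IsMarkovKernel (T θ)) (hm : ∀ θ, Measurable (ℓ θ)) (L₀ L₂ : ℝ)
    (hL₀ : ∀ θ₁ θ₂ z, |ℓ θ₁ z - ℓ θ₂ z| ≤ L₀ * ‖θ₁ - θ₂‖)
    (hL₂ : ∀ θ₁ θ₂ z, tvDistance (T θ₁ z) (T θ₂ z) ≤ L₂ * ‖θ₁ - θ₂‖)
    (lam : ℝ) (η δ : ℕ → ℝ) (τ : ℕ → ℕ) (μ₀ : Measure (EuclideanSpace ℝ (Fin d) × Z))
    (hμ₀ : IsProbabilityMeasure μ₀) (k : ℕ) :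
    IsProbabilityMeasure (dfoLaw T ℓ lam η δ τ μ₀ k) := by
  have : NeZero d := ⟨hd.ne'⟩
  have := isProbabilityMeasure_uniformSphere (d := d)
  have hTm := measurable_uncurry_kernel T hT L₂ hL₂
  have hℓ := measurable_uncurry_loss ℓ hm L₀ hL₀
  induction k with
  | zero => exact hμ₀
  | succ k ih =>
    have hi := measurable_dfoInner T ℓ hT hTm hℓ lam (η k) (δ k) (τ k) (τ k)
    refine isProbabilityMeasure_bind_of_measurable _ _ ?_ fun s => ?_
    · exact measurable_bind_param _ measurable_const (fun _ => inferInstance) _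
        (hi.1.comp measurable_swap)
    · exact isProbabilityMeasure_bind_of_measurable _ _
        (hi.1.comp measurable_prodMk_right) fun u => hi.2 u s

end

/-! The performative risk is bounded by `G` and Lipschitz with constant K = `L₀ + 2 * G * L₁`, but
it need not be differentiable. Averaging it over a ball of radius δ makes it so. By the divergence
theorem the gradient is (d/δ) E[𝓛(θ + δu) u] with u uniform on the sphere. Hence the gradient is
Lipschitz with constant (d/δ)K, and a loss observed at θ + δu, multiplied by (d/δ)u, estimates it
without bias as soon as the sample is stationary (`hasGradientAt_ballAverage`).

Within an epoch the sample is not stationary. The weights λ^(τ-m) form a geometric series, so the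
parameter moves by O(η d/δ) in total. The chain therefore stays within O(η d/δ) of the one with
frozen parameter, which mixes geometrically (`abs_integral_loss_sub_performativeRisk_le`). Summing
the steps, the mean displacement tested against the gradient v is -η W ‖v‖², where W ≥ 1 is the sum
of the weights, up to a small bias.

A first-order expansion of the smoothed risk then gives a descent inequality per epoch
(`integral_epoch_smoothedRisk_le`). After division by η, its errors are a drift term of order
η(d/δ)², a mixing term (d/δ) τ max(ρ, λ)^τ, and a curvature term η(d/δ)³. With τ logarithmic in k
they are of order k^(2β-α), k^(β-α) and k^(3β-α), so curvature dominates.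

Dividing by η_k and summing by parts costs a multiple of 1/η_N, of order N^α, because the risk is
bounded. The change of radius between epochs is absorbed by adding K δ_k to the potential. Averaging
yields the rates N^(α-1) and N^(3β-α). The bias bound is |𝓛_δ - 𝓛| ≤ Kδ, averaged. -/

noncomputable section

/-! ### Polar coordinates. -/

section Polar

variable {E : Type*} [NormedAddCommGroup E] [NormedSpace ℝ E] [MeasurableSpace E] [BorelSpace E]
  [FiniteDimensional ℝ E] [Nontrivial E] (μ : Measure E) [μ.IsAddHaarMeasure]

/-- Integration in polar coordinates with respect to a Haar measure. -/
theorem integral_eq_integral_Ioi_toSphere {g : E → ℝ} (hg : Integrable g μ) :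
    ∫ x, g x ∂μ = ∫ r in Set.Ioi (0 : ℝ),
      r ^ (Module.finrank ℝ E - 1) * ∫ u, g (r • (u : E)) ∂μ.toSphere := by
  have hmp := μ.measurePreserving_homeomorphUnitSphereProd
  have hemb := (homeomorphUnitSphereProd E).measurableEmbedding
  let k : Metric.sphere (0 : E) 1 × Set.Ioi (0 : ℝ) → ℝ := fun p => g ((p.2 : ℝ) • (p.1 : E))
  have hk : ∀ x : ({0}ᶜ : Set E), k (homeomorphUnitSphereProd E x) = g x := by
    intro x
    have : ‖(x : E)‖ ≠ 0 := norm_ne_zero_iff.2 x.2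
    simp [k, smul_smul, this]
  have hkint : Integrable k (μ.toSphere.prod (.volumeIoiPow (Module.finrank ℝ E - 1))) := by
    rw [← hmp.integrable_comp_emb hemb]
    have : k ∘ homeomorphUnitSphereProd E = g ∘ Subtype.val := funext hk
    rw [this, ← (MeasurableEmbedding.subtype_coe
      (measurableSet_singleton (0 : E)).compl).integrableOn_range_iff_comap]
    exact hg.integrableOn
  -- The origin is null; without it the space is homeomorphic to the product of the sphere and the
  -- half-line, where Fubini applies.
  calc ∫ x, g x ∂μ = ∫ x : ({0}ᶜ : Set E), g x ∂(μ.comap (↑)) := by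
        rw [integral_subtype_comap (measurableSet_singleton (0 : E)).compl g,
          restrict_compl_singleton]
    _ = ∫ p, k p ∂(μ.toSphere.prod (.volumeIoiPow (Module.finrank ℝ E - 1))) := by
        rw [← hmp.integral_comp hemb]
        simp_rw [hk]
    _ = ∫ r, ∫ u, k (u, r) ∂μ.toSphere ∂(.volumeIoiPow (Module.finrank ℝ E - 1)) :=
        integral_prod_symm _ hkint
    _ = _ := by
        simp only [Measure.volumeIoiPow, ENNReal.ofReal]
        rw [integral_withDensity_eq_integral_smul
            (measurable_subtype_coe.pow_const _).real_toNNReal,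
          integral_subtype_comap measurableSet_Ioi fun r => Real.toNNReal
            (r ^ (Module.finrank ℝ E - 1)) • ∫ u, g (r • (u : E)) ∂μ.toSphere]
        refine setIntegral_congr_fun measurableSet_Ioi fun r hr => ?_
        simp only [NNReal.smul_def, smul_eq_mul, Real.coe_toNNReal _ (pow_nonneg hr.out.le _)]

end Polar

/-! ### The divergence theorem on the unit ball for Lipschitz functions. -/

section Divergence

open Filter Topology

/-- The tent (R - ‖x‖)₊ is the test function for integration by parts: it is Lipschitz with compact
support, and its derivative in R is the indicator of the ball of radius R, up to a null set. -/
theorem lipschitzWith_max_sub_norm {E : Type*} [NormedAddCommGroup E] (R : ℝ) :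
    LipschitzWith 1 fun x : E => max (R - ‖x‖) 0 := by
  have h : LipschitzWith 1 fun x : E => R - ‖x‖ := by
    refine LipschitzWith.of_dist_le_mul fun x y => ?_
    simpa [Real.dist_eq, dist_eq_norm, abs_sub_comm] using abs_norm_sub_norm_le x y
  exact h.max_const 0

variable {E : Type*} [NormedAddCommGroup E] [InnerProductSpace ℝ E]

theorem hasCompactSupport_max_sub_norm [FiniteDimensional ℝ E] (R : ℝ) :
    HasCompactSupport fun x : E => max (R - ‖x‖) 0 := by
  refine HasCompactSupport.of_support_subset_isCompact (isCompact_closedBall (0 : E) R) ?_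
  intro x hx
  by_contra h
  have : R < ‖x‖ := by simpa using h
  exact hx (max_eq_right (by linarith))

theorem hasLineDerivAt_norm {x : E} (hx : x ≠ 0) (v : E) :
    HasLineDerivAt ℝ (fun y : E => ‖y‖) (‖x‖⁻¹ * inner ℝ x v) x v := by
  have h := ((hasStrictFDerivAt_norm_sq x).hasFDerivAt.hasLineDerivAt v).sqrt
    (by simpa using hx)
  simp only [Real.sqrt_sq (norm_nonneg _)] at h
  convert h using 1
  simp [HasLineDerivAt]
  field_simp

theorem lineDeriv_max_sub_norm {R : ℝ} {x : E} (hx : x ≠ 0) (hR : ‖x‖ ≠ R) (v : E) :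
    lineDeriv ℝ (fun y : E => max (R - ‖y‖) 0) x (-v) =
      (Metric.ball (0 : E) R).indicator (fun y => ‖y‖⁻¹ * inner ℝ y v) x := by
  have hc : Continuous fun y : E => ‖y‖ := continuous_norm
  rcases lt_or_gt_of_ne hR with h | h
  · rw [Set.indicator_of_mem (by simpa using h)]
    have e : (fun y : E => max (R - ‖y‖) 0) =ᶠ[𝓝 x] fun y => R - ‖y‖ := by
      filter_upwards [hc.continuousAt.eventually_lt continuousAt_const h] with y hy
      exact max_eq_left (by linarith)
    rw [e.lineDeriv_eq]
    have h2 := HasDerivAt.const_sub R (hasLineDerivAt_norm hx (-v))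
    rw [lineDeriv, h2.deriv]
    simp
  · rw [Set.indicator_of_notMem (by simpa using h.le)]
    have e : (fun y : E => max (R - ‖y‖) 0) =ᶠ[𝓝 x] fun y => 0 := by
      filter_upwards [continuousAt_const.eventually_lt hc.continuousAt h] with y hy
      exact max_eq_right (by linarith)
    rw [e.lineDeriv_eq]
    simp [lineDeriv]

variable [MeasurableSpace E] [BorelSpace E] [FiniteDimensional ℝ E] [Nontrivial E]
  (μ : Measure E) [μ.IsAddHaarMeasure]

/-- The derivative of the radial tent `(R - ‖x‖)₊`, integrated against `f`, in polar
coordinates. -/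
theorem integral_lineDeriv_max_sub_norm_mul {f : E → ℝ} (hf : Continuous f) (v : E) {R : ℝ}
    (hR : 0 < R) :
    ∫ x, lineDeriv ℝ (fun y : E => max (R - ‖y‖) 0) x (-v) * f x ∂μ =
      ∫ r in (0 : ℝ)..R, r ^ (Module.finrank ℝ E - 1) *
        ∫ u, f (r • (u : E)) * inner ℝ (u : E) v ∂μ.toSphere := by
  -- The tent fails to be differentiable only at the origin and on the sphere of radius R, both
  -- null.
  have hae : (fun x => lineDeriv ℝ (fun y : E => max (R - ‖y‖) 0) x (-v) * f x) =ᵐ[μ]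
      (Metric.ball (0 : E) R).indicator fun x => ‖x‖⁻¹ * inner ℝ x v * f x := by
    have h0 : ∀ᵐ x ∂μ, x ≠ 0 := by simp [ae_iff]
    have h1 : ∀ᵐ x ∂μ, x ∉ Metric.sphere (0 : E) R :=
      measure_eq_zero_iff_ae_notMem.1 (Measure.addHaar_sphere_of_ne_zero μ 0 hR.ne')
    filter_upwards [h0, h1] with x hx hx'
    rw [lineDeriv_max_sub_norm hx (by simpa using hx')]
    exact (Set.indicator_mul_left _ _ _).symm
  have hm : Measurable fun x : E => ‖x‖⁻¹ * inner ℝ x v * f x := by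
    have := hf.measurable
    fun_prop
  have hint : Integrable
      ((Metric.ball (0 : E) R).indicator fun x => ‖x‖⁻¹ * inner ℝ x v * f x) μ := by
    rw [integrable_indicator_iff measurableSet_ball]
    obtain ⟨B, hB⟩ := (isCompact_closedBall (0 : E) R).exists_bound_of_continuousOn hf.continuousOn
    refine Measure.integrableOn_of_bounded (M := ‖v‖ * B) measure_ball_lt_top.ne
      hm.aestronglyMeasurable ?_
    filter_upwards [ae_restrict_mem measurableSet_ball] with x hx
    rw [norm_mul]
    refine mul_le_mul ?_ (hB x (Metric.ball_subset_closedBall hx)) (norm_nonneg _) (norm_nonneg _)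
    rw [norm_mul, norm_inv, norm_norm]
    rcases eq_or_ne x 0 with rfl | h
    · simp
    · rw [inv_mul_le_iff₀ (norm_pos_iff.2 h)]
      exact norm_inner_le_norm _ _
  rw [integral_congr_ae hae, integral_eq_integral_Ioi_toSphere μ hint,
    intervalIntegral.integral_of_le hR.le, integral_Ioc_eq_integral_Ioo,
    ← Set.Ioi_inter_Iio, ← setIntegral_indicator measurableSet_Iio]
  refine setIntegral_congr_fun measurableSet_Ioi fun r hr => ?_
  have hr : 0 < r := hr
  have hn : ∀ u : Metric.sphere (0 : E) 1, ‖r • (u : E)‖ = r := fun u => by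
    simp [norm_smul, abs_of_pos hr]
  by_cases h : r < R
  · rw [Set.indicator_of_mem (by exact h)]
    congr 1
    refine integral_congr_ae (Eventually.of_forall fun u => ?_)
    simp only
    rw [Set.indicator_of_mem (by simpa [hn u] using h), hn, real_inner_smul_left]
    field_simp
  · rw [Set.indicator_of_notMem (by exact h)]
    have : ∀ u : Metric.sphere (0 : E) 1, (Metric.ball (0 : E) R).indicator
        (fun x => ‖x‖⁻¹ * inner ℝ x v * f x) (r • (u : E)) = 0 := fun u =>
      Set.indicator_of_notMem (by simpa [hn u] using h) _
    simp [this]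

/-- The divergence theorem on the unit ball for Lipschitz functions. -/
theorem integral_ball_lineDeriv_eq_integral_toSphere {f : E → ℝ} {C : NNReal}
    (hf : LipschitzWith C f) (v : E) :
    ∫ x in Metric.ball (0 : E) 1, lineDeriv ℝ f x v ∂μ =
      ∫ u, f (u : E) * inner ℝ (u : E) v ∂μ.toSphere := by
  have hld : Measurable fun x => lineDeriv ℝ f x v := measurable_lineDeriv hf.continuous
  have hldb : ∀ x, |lineDeriv ℝ f x v| ≤ C * ‖v‖ := fun x => norm_lineDeriv_le_of_lipschitz ℝ hf
  have hB : 0 ≤ C * ‖v‖ := by positivity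
  have hs : Continuous fun r : ℝ => r ^ (Module.finrank ℝ E - 1) *
        ∫ u, f (r • (u : E)) * inner ℝ (u : E) v ∂μ.toSphere := by
    refine (continuous_pow _).mul ?_
    have := continuous_parametric_integral_of_continuous (μ := μ.toSphere)
      (f := fun (r : ℝ) (u : Metric.sphere (0 : E) 1) => f (r • (u : E)) * inner ℝ (u : E) v)
      (by have := hf.continuous; fun_prop) isCompact_univ
    simpa using this
  -- The same function of R is differentiated at 1 in two ways. Here integration by parts moves the
  -- derivative onto the tent, and the fundamental theorem of calculus applied to the polar form
  -- leaves the sphere integral.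
  have h1 : HasDerivAt (fun R : ℝ => ∫ x, lineDeriv ℝ f x v * max (R - ‖x‖) 0 ∂μ)
      (∫ u, f (u : E) * inner ℝ (u : E) v ∂μ.toSphere) 1 := by
    have := intervalIntegral.integral_hasDerivAt_right (hs.intervalIntegrable 0 1)
      hs.stronglyMeasurable.stronglyMeasurableAtFilter hs.continuousAt
    simp only [one_pow, one_mul, one_smul] at this
    refine this.congr_of_eventuallyEq ?_
    filter_upwards [lt_mem_nhds (zero_lt_one (α := ℝ))] with R hR
    rw [← integral_lineDeriv_max_sub_norm_mul μ hf.continuous v hR]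
    exact hf.integral_lineDeriv_mul_eq (lipschitzWith_max_sub_norm R)
      (hasCompactSupport_max_sub_norm R) v
  -- Second way: differentiating under the integral leaves the integral over the ball. Restricting
  -- to R < 2 makes the tents vanish outside the ball of radius 2, which gives an integrable
  -- Lipschitz bound.
  have h2 := (hasDerivAt_integral_of_dominated_loc_of_lip (𝕜 := ℝ) (μ := μ) (x₀ := (1 : ℝ))
    (s := Set.Iio 2)
    (F := fun R x => lineDeriv ℝ f x v * max (R - ‖x‖) 0)
    (F' := (Metric.ball (0 : E) 1).indicator fun x => lineDeriv ℝ f x v)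
    (bound := (Metric.ball (0 : E) 2).indicator fun _ => C * ‖v‖)
    (Iio_mem_nhds (by norm_num)) (Eventually.of_forall fun R => by fun_prop) ?_
    (hld.indicator measurableSet_ball).aestronglyMeasurable ?_ ?_ ?_).2
  · rw [integral_indicator measurableSet_ball] at h2
    exact h2.unique h1
  · exact ((lipschitzWith_max_sub_norm (E := E) 1).continuous.integrable_of_hasCompactSupport
      (hasCompactSupport_max_sub_norm 1)).bdd_mul hld.aestronglyMeasurable
      (Eventually.of_forall hldb)
  · refine Eventually.of_forall fun x => LipschitzOnWith.of_dist_le_mul fun a ha b hb => ?_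
    by_cases hx : x ∈ Metric.ball (0 : E) 2
    · rw [Set.indicator_of_mem hx, Real.dist_eq, Real.dist_eq, ← mul_sub, abs_mul,
        Real.coe_nnabs, abs_of_nonneg hB]
      refine mul_le_mul (hldb x) ?_ (abs_nonneg _) hB
      exact (abs_max_sub_max_le_abs _ _ _).trans (by simp)
    · have hx2 : 2 ≤ ‖x‖ := by simpa using hx
      have ha' : a < 2 := ha
      have hb' : b < 2 := hb
      rw [max_eq_right (by linarith), max_eq_right (by linarith), mul_zero, dist_self]
      positivity
  · rw [integrable_indicator_iff measurableSet_ball]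
    exact integrableOn_const measure_ball_lt_top.ne
  · have h1 : ∀ᵐ x ∂μ, x ∉ Metric.sphere (0 : E) 1 :=
      measure_eq_zero_iff_ae_notMem.1 (Measure.addHaar_sphere_of_ne_zero μ 0 one_ne_zero)
    filter_upwards [h1] with x hx
    have hx' : ‖x‖ ≠ 1 := by simpa using hx
    rcases lt_or_gt_of_ne hx' with h | h
    · rw [Set.indicator_of_mem (by simpa using h)]
      have : HasDerivAt (fun R : ℝ => lineDeriv ℝ f x v * (R - ‖x‖)) (lineDeriv ℝ f x v * 1) 1 :=
        ((hasDerivAt_id _).sub_const _).const_mul _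
      rw [mul_one] at this
      refine this.congr_of_eventuallyEq ?_
      filter_upwards [lt_mem_nhds h] with R hR
      rw [max_eq_left (by linarith)]
    · rw [Set.indicator_of_notMem (by simpa using h.le)]
      refine (hasDerivAt_const (1 : ℝ) (0 : ℝ)).congr_of_eventuallyEq ?_
      filter_upwards [gt_mem_nhds h] with R hR
      rw [max_eq_right (by linarith), mul_zero]

end Divergence

/-! ### Ball averages of Lipschitz functions and their gradients. -/

section Smoothing

open Filter Topology

theorem nontrivial_euclideanSpace {d : ℕ} (hd : 0 < d) :
    Nontrivial (EuclideanSpace ℝ (Fin d)) := by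
  refine Module.nontrivial_of_finrank_pos (R := ℝ) ?_
  simpa using hd

/-- The surface measure of the sphere is d times the volume of the ball; this ratio is the source of
the factor d in the gradient formula. -/
theorem integral_uniformSphere {d : ℕ} {F : Type*} [NormedAddCommGroup F] [NormedSpace ℝ F]
    (h : EuclideanSpace ℝ (Fin d) → F) :
    ∫ u, h u ∂(uniformSphere d) =
      ((d : ℝ) * (volume : Measure (EuclideanSpace ℝ (Fin d))).real (Metric.ball 0 1))⁻¹ •
        ∫ u, h u ∂(volume : Measure (EuclideanSpace ℝ (Fin d))).toSphere := by
  rw [uniformSphere, (MeasurableEmbedding.subtype_coe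
    Metric.isClosed_sphere.measurableSet).integral_map, ProbabilityTheory.cond,
    Measure.restrict_univ, integral_smul_measure]
  simp [ENNReal.toReal_mul, measureReal_def, mul_comm]

theorem ae_norm_uniformSphere (d : ℕ) : ∀ᵐ u ∂(uniformSphere d), ‖u‖ = 1 := by
  rw [uniformSphere, (MeasurableEmbedding.subtype_coe
    Metric.isClosed_sphere.measurableSet).ae_map_iff]
  exact Eventually.of_forall fun u => by simp

theorem integrable_smul_uniformSphere {d : ℕ} (hd : 0 < d) {f : EuclideanSpace ℝ (Fin d) → ℝ}
    (hf : Continuous f) (δ : ℝ) (θ : EuclideanSpace ℝ (Fin d)) :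
    Integrable (fun u => f (θ + δ • u) • u) (uniformSphere d) := by
  have : NeZero d := ⟨hd.ne'⟩
  have := isProbabilityMeasure_uniformSphere (d := d)
  have hc : Continuous fun u => f (θ + δ • u) := by fun_prop
  obtain ⟨B, hB⟩ :=
    (isCompact_sphere (0 : EuclideanSpace ℝ (Fin d)) 1).exists_bound_of_continuousOn hc.continuousOn
  refine Integrable.of_bound (hc.smul continuous_id).aestronglyMeasurable B ?_
  filter_upwards [ae_norm_uniformSphere d] with u hu
  simpa [norm_smul, hu] using hB u (by simpa using hu)

/-- The average of `f` over the ball of radius `δ` centred at `θ`. -/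
def ballAverage {d : ℕ} (δ : ℝ) (f : EuclideanSpace ℝ (Fin d) → ℝ)
    (θ : EuclideanSpace ℝ (Fin d)) : ℝ :=
  ⨍ w in Metric.closedBall (0 : EuclideanSpace ℝ (Fin d)) 1, f (θ + δ • w)

/-- The gradient of the ball average of a Lipschitz function is a spherical average. -/
theorem hasGradientAt_ballAverage {d : ℕ} (hd : 0 < d) {f : EuclideanSpace ℝ (Fin d) → ℝ}
    {C : NNReal} (hf : LipschitzWith C f) {δ : ℝ} (hδ : 0 < δ) (θ : EuclideanSpace ℝ (Fin d)) :
    HasGradientAt (ballAverage δ f) (((d : ℝ) / δ) • ∫ u, f (θ + δ • u) • u ∂(uniformSphere d)) θ := by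
  have := nontrivial_euclideanSpace hd
  set V := (volume : Measure (EuclideanSpace ℝ (Fin d))).real (Metric.ball 0 1) with hV
  have hVpos : 0 < V := ENNReal.toReal_pos
    (Metric.measure_ball_pos _ _ one_pos).ne' measure_ball_lt_top.ne
  have hball : (Metric.ball (0 : EuclideanSpace ℝ (Fin d)) 1) =ᵐ[volume] Metric.closedBall (0 : EuclideanSpace ℝ (Fin d)) 1 :=
    ae_eq_of_subset_of_measure_ge Metric.ball_subset_closedBall
      (Measure.addHaar_closedBall_eq_addHaar_ball _ _ _).le
      measurableSet_ball.nullMeasurableSet measure_closedBall_lt_top.ne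
  let g : EuclideanSpace ℝ (Fin d) → ℝ := fun w => f (θ + δ • w)
  have hg : LipschitzWith (C * δ.toNNReal) g := by
    refine hf.comp (LipschitzWith.of_dist_le_mul fun x y => ?_)
    rw [dist_add_left, dist_smul₀, Real.coe_toNNReal _ hδ.le, Real.norm_of_nonneg hδ.le]
  -- Moving the centre amounts to translating w. So Rademacher's theorem, which gives
  -- differentiability of `g` at almost every w, gives differentiability in the centre at `θ` for
  -- almost every w.
  have hfg : ∀ x w, f (x + δ • w) = g (w + δ⁻¹ • (x - θ)) := by
    intro x w
    simp only [g, smul_add, smul_smul, mul_inv_cancel₀ hδ.ne', one_smul]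
    congr 1
    abel
  have hcont : ∀ x, Continuous fun w => f (x + δ • w) := fun x => by
    have := hf.continuous
    fun_prop
  have hgd : ∀ᵐ w ∂(volume : Measure (EuclideanSpace ℝ (Fin d))), DifferentiableAt ℝ g w := hg.ae_differentiableAt
  have hmain := hasFDerivAt_integral_of_dominated_loc_of_lip (𝕜 := ℝ)
    (μ := (volume : Measure (EuclideanSpace ℝ (Fin d))).restrict (Metric.closedBall 0 1)) (x₀ := θ) (s := Set.univ)
    (F := fun x w => f (x + δ • w)) (F' := fun w => δ⁻¹ • fderiv ℝ g w) (bound := fun _ => C)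
    univ_mem (Eventually.of_forall fun x => (hcont x).aestronglyMeasurable)
    ((hcont θ).continuousOn.integrableOn_compact (isCompact_closedBall _ _))
    ((measurable_fderiv ℝ g).const_smul δ⁻¹).aestronglyMeasurable
    (Eventually.of_forall fun w => by
      refine LipschitzOnWith.of_dist_le_mul fun x _ y _ => ?_
      simpa [Real.dist_eq] using hf.dist_le_mul (x + δ • w) (y + δ • w))
    (integrableOn_const measure_closedBall_lt_top.ne)
    (by
      filter_upwards [ae_restrict_of_ae hgd] with w hw
      simp_rw [hfg]
      have h1 : HasFDerivAt (fun x : EuclideanSpace ℝ (Fin d) => w + δ⁻¹ • (x - θ)) (δ⁻¹ • ContinuousLinearMap.id ℝ (EuclideanSpace ℝ (Fin d))) θ :=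
        (((hasFDerivAt_id θ).sub_const θ).const_smul δ⁻¹).const_add w
      have h2 : HasFDerivAt g (fderiv ℝ g w) (w + δ⁻¹ • (θ - θ)) := by
        simpa using hw.hasFDerivAt
      refine (h2.comp θ h1).congr_fderiv ?_
      rw [ContinuousLinearMap.comp_smul, ContinuousLinearMap.comp_id])
  rw [hasGradientAt_iff_hasFDerivAt]
  unfold ballAverage
  simp_rw [setAverage_eq]
  refine HasFDerivAt.congr_fderiv (hmain.2.const_smul
    ((volume : Measure (EuclideanSpace ℝ (Fin d))).real (Metric.closedBall 0 1))⁻¹)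
    (ContinuousLinearMap.ext fun v => ?_)
  rw [smul_apply, ContinuousLinearMap.integral_apply hmain.1,
    InnerProductSpace.toDual_apply_apply, real_inner_smul_left, real_inner_comm,
    ← integral_inner (integrable_smul_uniformSphere hd hf.continuous δ θ), integral_uniformSphere]
  have h3 : ∫ w in Metric.closedBall (0 : EuclideanSpace ℝ (Fin d)) 1, (δ⁻¹ • fderiv ℝ g w) v =
      δ⁻¹ * ∫ u, g (u : EuclideanSpace ℝ (Fin d)) * inner ℝ (u : EuclideanSpace ℝ (Fin d)) v ∂(volume : Measure (EuclideanSpace ℝ (Fin d))).toSphere := by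
    rw [← integral_ball_lineDeriv_eq_integral_toSphere volume hg v, ← integral_const_mul,
      setIntegral_congr_set hball]
    refine integral_congr_ae ?_
    filter_upwards [ae_restrict_of_ae hgd] with w hw
    simp [hw.lineDeriv_eq_fderiv]
  have hVc : (volume : Measure (EuclideanSpace ℝ (Fin d))).real (Metric.closedBall 0 1) = V := by
    rw [hV, measureReal_congr hball]
  rw [h3, hVc, ← hV]
  simp only [real_inner_smul_right, real_inner_comm, smul_eq_mul, g]
  have : (d : ℝ) ≠ 0 := by positivity
  field_simp


/-- Function, radius and centre may all differ, so that the sup bound, the Lipschitz bound in the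
centre and the Lipschitz bound in the radius are all instances. -/
theorem abs_ballAverage_sub_le {d : ℕ} {f g : EuclideanSpace ℝ (Fin d) → ℝ}
    (hf : Continuous f) (hg : Continuous g) {δ ε B : ℝ} {θ θ' : EuclideanSpace ℝ (Fin d)}
    (h : ∀ w : EuclideanSpace ℝ (Fin d), ‖w‖ ≤ 1 → |f (θ + δ • w) - g (θ' + ε • w)| ≤ B) :
    |ballAverage δ f θ - ballAverage ε g θ'| ≤ B := by
  have hpos : (volume : Measure (EuclideanSpace ℝ (Fin d))) (Metric.closedBall 0 1) ≠ 0 :=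
    (Metric.measure_closedBall_pos _ _ one_pos).ne'
  have hfin : (volume : Measure (EuclideanSpace ℝ (Fin d))) (Metric.closedBall 0 1) ≠ ⊤ :=
    measure_closedBall_lt_top.ne
  have hi : ∀ {k : EuclideanSpace ℝ (Fin d) → ℝ}, Continuous k →
      IntegrableOn k (Metric.closedBall 0 1) := fun hk =>
    hk.continuousOn.integrableOn_compact (isCompact_closedBall _ _)
  have e : ballAverage δ f θ - ballAverage ε g θ' =
      ⨍ w in Metric.closedBall (0 : EuclideanSpace ℝ (Fin d)) 1,
        (f (θ + δ • w) - g (θ' + ε • w)) := by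
    simp only [ballAverage, setAverage_eq]
    rw [integral_sub (hi (by fun_prop)) (hi (by fun_prop)), smul_sub]
  have hV : 0 < (volume : Measure (EuclideanSpace ℝ (Fin d))).real (Metric.closedBall 0 1) :=
    ENNReal.toReal_pos hpos hfin
  rw [e, setAverage_eq, smul_eq_mul, abs_mul, abs_of_nonneg (by positivity),
    inv_mul_le_iff₀ hV, mul_comm]
  exact norm_setIntegral_le_of_norm_le_const
    (f := fun w => f (θ + δ • w) - g (θ' + ε • w)) hfin.lt_top
    (fun w hw => h w (by simpa using hw))

theorem abs_ballAverage_le {d : ℕ} {f : EuclideanSpace ℝ (Fin d) → ℝ} (hf : Continuous f)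
    {G : ℝ} (h : ∀ x, |f x| ≤ G) (δ : ℝ) (θ : EuclideanSpace ℝ (Fin d)) :
    |ballAverage δ f θ| ≤ G := by
  have := abs_ballAverage_sub_le (g := fun _ => 0) hf continuous_const (δ := δ) (ε := 0)
    (θ := θ) (θ' := θ) (B := G) (fun w _ => by simpa using h _)
  simpa [ballAverage] using this

section Lipschitz

variable {d : ℕ} {f : EuclideanSpace ℝ (Fin d) → ℝ} {C : NNReal}

theorem abs_ballAverage_sub_ballAverage_le (hf : LipschitzWith C f) (δ ε : ℝ)
    (θ : EuclideanSpace ℝ (Fin d)) :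
    |ballAverage δ f θ - ballAverage ε f θ| ≤ C * |δ - ε| := by
  refine abs_ballAverage_sub_le hf.continuous hf.continuous fun w hw => ?_
  refine (hf.dist_le_mul _ _).trans ?_
  rw [dist_add_left, dist_eq_norm, ← sub_smul, norm_smul]
  exact mul_le_mul_of_nonneg_left (mul_le_of_le_one_right (norm_nonneg _) hw) C.2

theorem abs_ballAverage_sub_self_le (hf : LipschitzWith C f) {δ : ℝ} (hδ : 0 ≤ δ)
    (θ : EuclideanSpace ℝ (Fin d)) : |ballAverage δ f θ - f θ| ≤ C * δ := by
  have h := abs_ballAverage_sub_ballAverage_le hf δ 0 θ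
  have e : ballAverage 0 f θ = f θ := by
    simp only [ballAverage, zero_smul, add_zero]
    exact setAverage_const (Metric.measure_closedBall_pos _ _ one_pos).ne'
      measure_closedBall_lt_top.ne _
  rwa [e, sub_zero, abs_of_nonneg hδ] at h

theorem lipschitzWith_ballAverage (hf : LipschitzWith C f) (δ : ℝ) :
    LipschitzWith C (ballAverage δ f) := by
  refine LipschitzWith.of_dist_le_mul fun x y => ?_
  refine abs_ballAverage_sub_le hf.continuous hf.continuous fun w _ => ?_
  simpa [Real.dist_eq] using hf.dist_le_mul (x + δ • w) (y + δ • w)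

theorem norm_gradient_ballAverage_le (hf : LipschitzWith C f) (δ : ℝ)
    (θ : EuclideanSpace ℝ (Fin d)) : ‖gradient (ballAverage δ f) θ‖ ≤ C := by
  rw [gradient, LinearIsometryEquiv.norm_map]
  exact norm_fderiv_le_of_lipschitz ℝ (lipschitzWith_ballAverage hf δ)

variable {δ : ℝ}

theorem inner_gradient_ballAverage (hd : 0 < d) (hf : LipschitzWith C f) (hδ : 0 < δ)
    (θ v : EuclideanSpace ℝ (Fin d)) :
    inner ℝ (gradient (ballAverage δ f) θ) v =
      ((d : ℝ) / δ) * ∫ u, f (θ + δ • u) * inner ℝ v u ∂(uniformSphere d) := by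
  rw [(hasGradientAt_ballAverage hd hf hδ θ).gradient, real_inner_smul_left, real_inner_comm,
    ← integral_inner (integrable_smul_uniformSphere hd hf.continuous δ θ)]
  simp only [real_inner_smul_right]

/-- The gradient is a spherical mean of values of `f`, so it inherits their Lipschitz constant times
d/δ. This growth as δ shrinks is what produces the cubic term in the descent estimate. -/
theorem lipschitzWith_gradient_ballAverage (hd : 0 < d) (hf : LipschitzWith C f) (hδ : 0 < δ) :
    LipschitzWith (Real.toNNReal (d / δ) * C) (gradient (ballAverage δ f)) := by
  have : NeZero d := ⟨hd.ne'⟩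
  have := isProbabilityMeasure_uniformSphere (d := d)
  refine LipschitzWith.of_dist_le_mul fun x y => ?_
  rw [(hasGradientAt_ballAverage hd hf hδ x).gradient,
    (hasGradientAt_ballAverage hd hf hδ y).gradient, dist_eq_norm, ← smul_sub, norm_smul,
    ← integral_sub (integrable_smul_uniformSphere hd hf.continuous δ x)
      (integrable_smul_uniformSphere hd hf.continuous δ y), NNReal.coe_mul,
    Real.coe_toNNReal _ (by positivity), Real.norm_of_nonneg (by positivity), mul_assoc]
  refine mul_le_mul_of_nonneg_left ?_ (by positivity)
  refine (norm_integral_le_of_norm_le_const (C := C * dist x y) ?_).trans (by simp)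
  filter_upwards [ae_norm_uniformSphere d] with u hu
  rw [← sub_smul, norm_smul, hu, mul_one]
  simpa [Real.dist_eq] using hf.dist_le_mul (x + δ • u) (y + δ • u)

/-- The first order expansion of the ball average, with a quadratic remainder. -/
theorem abs_ballAverage_sub_inner_le (hd : 0 < d) (hf : LipschitzWith C f) (hδ : 0 < δ)
    (x y : EuclideanSpace ℝ (Fin d)) :
    |ballAverage δ f y - ballAverage δ f x - inner ℝ (gradient (ballAverage δ f) x) (y - x)| ≤
      d / δ * C * ‖y - x‖ ^ 2 := by
  have hdiff : ∀ z, DifferentiableAt ℝ (ballAverage δ f) z := fun z =>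
    (hasGradientAt_ballAverage hd hf hδ z).differentiableAt
  -- The mean value inequality on the segment suffices; it gives up the usual factor 1/2 in the
  -- remainder.
  have h := (convex_segment (𝕜 := ℝ) x y).norm_image_sub_le_of_norm_hasFDerivWithin_le'
    (f := ballAverage δ f) (f' := fun z => fderiv ℝ (ballAverage δ f) z)
    (φ := fderiv ℝ (ballAverage δ f) x) (C := d / δ * C * ‖y - x‖)
    (fun z _ => (hdiff z).hasFDerivAt.hasFDerivWithinAt) (fun z hz => ?_)
    (left_mem_segment ℝ x y) (right_mem_segment ℝ x y)
  · have e : fderiv ℝ (ballAverage δ f) x (y - x) =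
        inner ℝ (gradient (ballAverage δ f) x) (y - x) := by
      simp [gradient]
    rw [e, mul_assoc, ← sq] at h
    exact h
  · have h1 := (lipschitzWith_gradient_ballAverage hd hf hδ).dist_le_mul z x
    rw [NNReal.coe_mul, Real.coe_toNNReal _ (by positivity), dist_eq_norm, gradient, gradient,
      ← map_sub, LinearIsometryEquiv.norm_map, dist_eq_norm] at h1
    refine h1.trans (mul_le_mul_of_nonneg_left ?_ (by positivity))
    obtain ⟨t, ⟨h0, ht⟩, rfl⟩ := (segment_eq_image' ℝ x y ▸ hz)
    rw [add_sub_cancel_left, norm_smul, Real.norm_of_nonneg h0]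
    exact mul_le_of_le_one_left (norm_nonneg _) ht

end Lipschitz

end Smoothing

/-! ### Total variation as a bound on integrals. -/

section TotalVariation

open Filter

variable {X : Type*} [MeasurableSpace X] (μ ν : Measure X) [IsProbabilityMeasure μ]
  [IsProbabilityMeasure ν]

theorem integrable_of_abs_le {h : X → ℝ} (hm : Measurable h) {B : ℝ} (hB : ∀ x, |h x| ≤ B) :
    Integrable h μ :=
  Integrable.of_bound hm.aestronglyMeasurable B (Eventually.of_forall hB)

theorem abs_integral_le_of_abs_le {h : X → ℝ} {B : ℝ} (hB : ∀ᵐ x ∂μ, |h x| ≤ B) :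
    |∫ x, h x ∂μ| ≤ B := by
  simpa using norm_integral_le_of_norm_le_const (μ := μ) (f := h) (C := B) hB

/-- Layer-cake formula: `h + B` takes values in [0, 2B], so its integral is that of the measures of
its superlevel sets over levels in (0, 2B], and each of these measures changes by at most the
distance. -/
theorem integral_sub_integral_le_tvDistance {h : X → ℝ} (hm : Measurable h) {B : ℝ}
    (hB0 : 0 ≤ B) (hB : ∀ x, |h x| ≤ B) :
    ∫ x, h x ∂μ - ∫ x, h x ∂ν ≤ 2 * B * tvDistance μ ν := by
  have key : ∀ (κ : Measure X) [IsProbabilityMeasure κ],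
      ∫ x, h x ∂κ = (∫ t in Set.Ioc 0 (2 * B), κ.real {x | t ≤ h x + B}) - B := by
    intro κ _
    have hi := integrable_of_abs_le κ hm hB
    have h1 := (hi.add (integrable_const B)).integral_eq_integral_Ioc_meas_le (M := 2 * B)
      (Eventually.of_forall fun x => by simp; linarith [(abs_le.1 (hB x)).1])
      (Eventually.of_forall fun x => by simp; linarith [(abs_le.1 (hB x)).2])
    simp only [Pi.add_apply] at h1
    rw [integral_add hi (integrable_const B), integral_const] at h1
    rw [← h1]
    simp
  have hint : ∀ (κ : Measure X) [IsProbabilityMeasure κ],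
      IntegrableOn (fun t => κ.real {x | t ≤ h x + B}) (Set.Ioc 0 (2 * B)) := by
    intro κ _
    have ha : Antitone fun t => κ.real {x | t ≤ h x + B} := fun s t hst =>
      measureReal_mono fun x hx => hst.trans hx
    exact ((ha.antitoneOn _).integrableOn_isCompact isCompact_Icc).mono_set Set.Ioc_subset_Icc_self
  rw [key μ, key ν, sub_sub_sub_cancel_right, ← integral_sub (hint μ) (hint ν)]
  have h2 := setIntegral_mono_on (μ := volume) (s := Set.Ioc 0 (2 * B))
    ((hint μ).sub (hint ν)) (integrableOn_const (C := tvDistance μ ν) measure_Ioc_lt_top.ne) measurableSet_Ioc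
    (fun t _ => le_tvDistance μ ν (measurableSet_le measurable_const (hm.add_const B)))
  refine h2.trans (le_of_eq ?_)
  simp [hB0, measureReal_def]

/-- Integrals of a bounded function against two laws differ by at most twice the bound times
the total variation distance. -/
theorem abs_integral_sub_integral_le_tvDistance {h : X → ℝ} (hm : Measurable h) {B : ℝ}
    (hB0 : 0 ≤ B) (hB : ∀ x, |h x| ≤ B) :
    |∫ x, h x ∂μ - ∫ x, h x ∂ν| ≤ 2 * B * tvDistance μ ν := by
  have h1 := integral_sub_integral_le_tvDistance μ ν hm hB0 hB
  have h2 := integral_sub_integral_le_tvDistance μ ν hm.neg hB0 (fun x => by simpa using hB x)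
  simp only [Pi.neg_apply, integral_neg] at h2
  rw [abs_le]
  constructor <;> linarith

end TotalVariation

/-! ### Integration against mixtures of laws. -/

section Bind

open Filter

variable {X Y : Type*} [MeasurableSpace X] [MeasurableSpace Y] {m : Measure X} {f : X → Measure Y}

theorem ae_bind_of_ae_ae (hf : Measurable f) {p : Y → Prop} (hp : MeasurableSet {y | p y})
    (h : ∀ᵐ x ∂m, ∀ᵐ y ∂(f x), p y) : ∀ᵐ y ∂(m.bind f), p y := by
  rw [ae_iff, Measure.bind_apply (by exact hp.compl) hf.aemeasurable]
  refine (lintegral_eq_zero_iff ((Measure.measurable_coe (by exact hp.compl)).comp hf)).2 ?_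
  filter_upwards [h] with x hx
  exact ae_iff.1 hx

theorem integral_bind [IsProbabilityMeasure m] (hf : Measurable f)
    (hp : ∀ x, IsProbabilityMeasure (f x)) {g : Y → ℝ} (hg : Integrable g (m.bind f)) :
    ∫ y, g y ∂(m.bind f) = ∫ x, ∫ y, g y ∂(f x) ∂m := by
  let κ : Kernel X Y := ⟨f, hf⟩
  have : IsMarkovKernel κ := ⟨hp⟩
  have e : m.bind f = (κ ∘ₖ Kernel.const Unit m) () := by
    rw [Kernel.comp_apply, Kernel.const_apply]
    rfl
  rw [e] at hg ⊢
  rw [Kernel.integral_comp hg, Kernel.const_apply]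
  rfl

theorem measurable_integral_param (hf : Measurable f) (hp : ∀ x, IsProbabilityMeasure (f x))
    {g : X → Y → ℝ} (hg : Measurable (Function.uncurry g)) :
    Measurable fun x => ∫ y, g x y ∂(f x) := by
  let κ : Kernel X Y := ⟨f, hf⟩
  have : IsMarkovKernel κ := ⟨hp⟩
  exact (hg.stronglyMeasurable.integral_kernel_prod_right (κ := κ)).measurable

end Bind

/-! ### One epoch with a fixed direction: drift, frozen chain and bias. -/

section Epoch

open Filter

variable {d : ℕ} {Z : Type*} [MeasurableSpace Z]

/-- The standing assumptions on the loss, the kernels and their stationary laws. -/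
structure DfoSetting (ℓ : EuclideanSpace ℝ (Fin d) → Z → ℝ)
    (T : EuclideanSpace ℝ (Fin d) → Kernel Z Z) (Pi : EuclideanSpace ℝ (Fin d) → Measure Z)
    (L₀ G L₁ L₂ M ρ : ℝ) : Prop where
  measurable_loss : ∀ θ, Measurable (ℓ θ)
  markov : ∀ θ, IsMarkovKernel (T θ)
  prob : ∀ θ, IsProbabilityMeasure (Pi θ)
  lip_loss : ∀ θ₁ θ₂ z, |ℓ θ₁ z - ℓ θ₂ z| ≤ L₀ * ‖θ₁ - θ₂‖
  bdd_loss : ∀ θ z, |ℓ θ z| ≤ G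
  lip_stationary : ∀ θ₁ θ₂, tvDistance (Pi θ₁) (Pi θ₂) ≤ L₁ * ‖θ₁ - θ₂‖
  mixing : ∀ θ (k : ℕ) z, tvDistance ((T θ ^ k) z) (Pi θ) ≤ M * ρ ^ k
  lip_kernel : ∀ θ₁ θ₂ z, tvDistance (T θ₁ z) (T θ₂ z) ≤ L₂ * ‖θ₁ - θ₂‖
  L₀_nonneg : 0 ≤ L₀
  G_nonneg : 0 ≤ G
  L₁_nonneg : 0 ≤ L₁
  L₂_nonneg : 0 ≤ L₂
  M_nonneg : 0 ≤ M
  ρ_nonneg : 0 ≤ ρ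

namespace DfoSetting

variable {ℓ : EuclideanSpace ℝ (Fin d) → Z → ℝ} {T : EuclideanSpace ℝ (Fin d) → Kernel Z Z}
  {Pi : EuclideanSpace ℝ (Fin d) → Measure Z} {L₀ G L₁ L₂ M ρ : ℝ}
  (S : DfoSetting ℓ T Pi L₀ G L₁ L₂ M ρ)

include S

theorem measurable_kernel : Measurable fun p : EuclideanSpace ℝ (Fin d) × Z => T p.1 p.2 :=
  measurable_uncurry_kernel T S.markov L₂ S.lip_kernel

theorem measurable_uncurry : Measurable (Function.uncurry ℓ) :=
  measurable_uncurry_loss ℓ S.measurable_loss L₀ S.lip_loss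

theorem abs_performativeRisk_le (θ : EuclideanSpace ℝ (Fin d)) : |performativeRisk ℓ Pi θ| ≤ G := by
  have := S.prob θ
  exact abs_integral_le_of_abs_le _ (Eventually.of_forall (S.bdd_loss θ))

/-- The loss is changed first under a fixed law, at cost `L₀`, then the law under a fixed loss, at
cost `2 * G * L₁`. -/
theorem lipschitzWith_performativeRisk :
    LipschitzWith (Real.toNNReal (L₀ + 2 * G * L₁)) (performativeRisk ℓ Pi) := by
  have h0 := S.L₀_nonneg
  have hG := S.G_nonneg
  have h1 := S.L₁_nonneg
  refine LipschitzWith.of_dist_le_mul fun x y => ?_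
  have := S.prob x
  have := S.prob y
  rw [Real.coe_toNNReal _ (by positivity), Real.dist_eq, dist_eq_norm]
  have hi := fun t => integrable_of_abs_le (Pi x) (S.measurable_loss t) (S.bdd_loss t)
  have e : performativeRisk ℓ Pi x - performativeRisk ℓ Pi y =
      (∫ z, (ℓ x z - ℓ y z) ∂(Pi x)) + (∫ z, ℓ y z ∂(Pi x) - ∫ z, ℓ y z ∂(Pi y)) := by
    rw [integral_sub (hi x) (hi y)]
    simp [performativeRisk]
  have h2 : |∫ z, (ℓ x z - ℓ y z) ∂(Pi x)| ≤ L₀ * ‖x - y‖ :=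
    abs_integral_le_of_abs_le _ (Eventually.of_forall (S.lip_loss x y))
  have h3 := abs_integral_sub_integral_le_tvDistance (Pi x) (Pi y) (S.measurable_loss y) hG
    (S.bdd_loss y)
  have h4 := mul_le_mul_of_nonneg_left (S.lip_stationary x y) (by positivity : 0 ≤ 2 * G)
  rw [e]
  refine (abs_add_le _ _).trans ?_
  linarith

theorem measurable_step (η δ w : ℝ) (u : EuclideanSpace ℝ (Fin d)) :
    Measurable (dfoStep T ℓ η δ w u) :=
  (measurable_dfoStep T ℓ S.markov S.measurable_kernel S.measurable_uncurry η δ w).1.comp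
    measurable_prodMk_left

theorem isProbabilityMeasure_step (η δ w : ℝ) (u : EuclideanSpace ℝ (Fin d))
    (s : EuclideanSpace ℝ (Fin d) × Z) : IsProbabilityMeasure (dfoStep T ℓ η δ w u s) :=
  (measurable_dfoStep T ℓ S.markov S.measurable_kernel S.measurable_uncurry η δ w).2 u s

theorem isProbabilityMeasure_inner (lam η δ : ℝ) (τ : ℕ) (u : EuclideanSpace ℝ (Fin d))
    (s : EuclideanSpace ℝ (Fin d) × Z) (m : ℕ) :
    IsProbabilityMeasure (dfoInner T ℓ lam η δ τ u s m) :=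
  (measurable_dfoInner T ℓ S.markov S.measurable_kernel S.measurable_uncurry lam η δ τ m).2 u s

theorem measurable_update (η δ w : ℝ) (u : EuclideanSpace ℝ (Fin d))
    (s : EuclideanSpace ℝ (Fin d) × Z) : Measurable fun z' : Z =>
      (s.1 - (η * w) • (((d : ℝ) / δ * ℓ (s.1 + δ • u) z') • u), z') := by
  have := S.measurable_loss (s.1 + δ • u)
  fun_prop

theorem integral_step (η δ w : ℝ) (u : EuclideanSpace ℝ (Fin d))
    (s : EuclideanSpace ℝ (Fin d) × Z) {g : EuclideanSpace ℝ (Fin d) × Z → ℝ}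
    (hg : Measurable g) :
    ∫ p, g p ∂(dfoStep T ℓ η δ w u s) =
      ∫ z', g (s.1 - (η * w) • (((d : ℝ) / δ * ℓ (s.1 + δ • u) z') • u), z')
        ∂(T (s.1 + δ • u) s.2) :=
  integral_map (S.measurable_update η δ w u s).aemeasurable hg.aestronglyMeasurable

theorem measurable_integral_shifted_kernel (δ : ℝ) (u : EuclideanSpace ℝ (Fin d))
    {g : EuclideanSpace ℝ (Fin d) × Z → Z → ℝ} (hg : Measurable (Function.uncurry g)) :
    Measurable fun p : EuclideanSpace ℝ (Fin d) × Z => ∫ z, g p z ∂(T (p.1 + δ • u) p.2) := by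
  have := S.markov
  refine measurable_integral_param ?_ (fun p => inferInstance) hg
  exact S.measurable_kernel.comp (f := fun p : EuclideanSpace ℝ (Fin d) × Z =>
    (p.1 + δ • u, p.2)) (by fun_prop)

theorem isMarkovKernel_pow (θ : EuclideanSpace ℝ (Fin d)) (m : ℕ) : IsMarkovKernel (T θ ^ m) := by
  have := S.markov θ
  induction m with
  | zero => exact inferInstanceAs (IsMarkovKernel (Kernel.id : Kernel Z Z))
  | succ m ih =>
    rw [pow_succ]
    exact inferInstanceAs (IsMarkovKernel ((T θ ^ m) ∘ₖ (T θ)))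

/-- The last transition is split off, in the order in which `dfoInner` is built, so that the two
chains can be compared by induction. -/
theorem integral_pow_succ (θ : EuclideanSpace ℝ (Fin d)) (m : ℕ) (z : Z) {h : Z → ℝ}
    (hm : Measurable h) {B : ℝ} (hB : ∀ z, |h z| ≤ B) :
    ∫ x, h x ∂((T θ ^ (m + 1)) z) = ∫ x, ∫ y, h y ∂(T θ x) ∂((T θ ^ m) z) := by
  have := S.markov θ
  have := S.isMarkovKernel_pow θ m
  have := S.isMarkovKernel_pow θ (m + 1)
  have e : T θ ^ (m + 1) = (T θ) ∘ₖ (T θ ^ m) := by rw [pow_succ']; rfl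
  have hi := integrable_of_abs_le ((T θ ^ (m + 1)) z) hm hB
  rw [e] at hi ⊢
  exact Kernel.integral_comp hi

variable {lam η δ : ℝ} (hlam : 0 ≤ lam) (hlam1 : lam < 1) (hη : 0 ≤ η) (hδ : 0 < δ) {τ : ℕ}
  {u : EuclideanSpace ℝ (Fin d)} (hu : ‖u‖ = 1) (s : EuclideanSpace ℝ (Fin d) × Z)

include hlam hlam1 hη hδ hu

/-- The drift of the parameter within an epoch. -/
theorem ae_norm_sub_inner_le {m : ℕ} (hmτ : m ≤ τ) :
    ∀ᵐ p ∂(dfoInner T ℓ lam η δ τ u s m),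
      ‖p.1 - s.1‖ ≤ η * (d / δ) * G * lam ^ (τ - m) / (1 - lam) := by
  have hG := S.G_nonneg
  have h1 : 0 < 1 - lam := by linarith
  -- The bound reproduces itself: with q = λ^(τ-(m+1)), the old bound plus the new step is
  -- proportional to λq/(1-λ) + q = q/(1-λ).
  induction m with
  | zero =>
    rw [dfoInner, ae_dirac_iff (measurableSet_le (by fun_prop) (by fun_prop))]
    simp only [sub_self, norm_zero]
    positivity
  | succ m ih =>
    refine ae_bind_of_ae_ae (S.measurable_step _ _ _ _)
      (measurableSet_le (by fun_prop) (by fun_prop)) ?_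
    filter_upwards [ih (by omega)] with p hp
    rw [dfoStep, ae_map_iff (S.measurable_update _ _ _ _ _).aemeasurable
      (measurableSet_le (by fun_prop) (by fun_prop))]
    refine Eventually.of_forall fun z' => ?_
    have e : τ - m = (τ - (m + 1)) + 1 := by omega
    rw [e, pow_succ] at hp
    set q := lam ^ (τ - (m + 1))
    have hq : 0 ≤ q := by positivity
    have h2 : ‖(η * q) • (((d : ℝ) / δ * ℓ (p.1 + δ • u) z') • u)‖ ≤ η * q * (d / δ * G) := by
      rw [norm_smul, norm_smul, hu, mul_one, Real.norm_of_nonneg (by positivity), norm_mul,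
        Real.norm_of_nonneg (r := (d : ℝ) / δ) (by positivity)]
      have := S.bdd_loss (p.1 + δ • u) z'
      rw [Real.norm_eq_abs]
      gcongr
    have h3 : ‖p.1 - (η * q) • (((d : ℝ) / δ * ℓ (p.1 + δ • u) z') • u) - s.1‖ ≤
        ‖p.1 - s.1‖ + ‖(η * q) • (((d : ℝ) / δ * ℓ (p.1 + δ • u) z') • u)‖ := by
      rw [sub_right_comm]
      exact norm_sub_le _ _
    refine (h3.trans (add_le_add hp h2)).trans (le_of_eq ?_)
    field_simp
    ring

/-- The law of the sample within an epoch is close to that of the chain with a frozen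
parameter. -/
theorem abs_integral_inner_sub_integral_pow_le {m : ℕ} (hmτ : m ≤ τ) {h : Z → ℝ}
    (hm : Measurable h) {B : ℝ} (hB0 : 0 ≤ B) (hB : ∀ z, |h z| ≤ B) :
    |∫ p, h p.2 ∂(dfoInner T ℓ lam η δ τ u s m) - ∫ z, h z ∂((T (s.1 + δ • u) ^ m) s.2)| ≤
      2 * B * L₂ * (η * (d / δ) * G * lam ^ (τ - m) / (1 - lam) ^ 2) := by
  have hG := S.G_nonneg
  have hL₂ := S.L₂_nonneg
  have h1 : 0 < 1 - lam := by linarith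
  have hT := S.markov
  -- The test function must vary: the last transition replaces `h` by its image under the frozen
  -- kernel, which obeys the same bound `B`.
  induction m generalizing h with
  | zero =>
    rw [dfoInner, integral_dirac' _ _ (by fun_prop), pow_zero]
    have e : (1 : Kernel Z Z) s.2 = Measure.dirac s.2 := Kernel.id_apply s.2
    rw [e, integral_dirac' _ _ hm.stronglyMeasurable, sub_self, abs_zero]
    positivity
  | succ m ih =>
    have hP := S.isProbabilityMeasure_inner lam η δ τ u s m
    have hP' := S.isProbabilityMeasure_inner lam η δ τ u s (m + 1)
    have hint := integrable_of_abs_le (dfoInner T ℓ lam η δ τ u s (m + 1))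
      (h := fun p => h p.2) (by fun_prop) (fun p => hB p.2)
    rw [S.integral_pow_succ _ _ _ hm hB, dfoInner,
      integral_bind (S.measurable_step _ _ _ _) (S.isProbabilityMeasure_step _ _ _ _) hint]
    simp_rw [S.integral_step _ _ _ _ _ (g := fun p => h p.2) (by fun_prop)]
    have hm1 : Measurable fun z => ∫ y, h y ∂(T (s.1 + δ • u) z) :=
      measurable_integral_param (Kernel.measurable _) (fun _ => inferInstance)
        (hm.comp measurable_snd)
    have hB1 : ∀ z, |∫ y, h y ∂(T (s.1 + δ • u) z)| ≤ B := fun z =>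
      abs_integral_le_of_abs_le _ (Eventually.of_forall hB)
    have hm2 : Measurable fun p : EuclideanSpace ℝ (Fin d) × Z =>
        ∫ y, h y ∂(T (p.1 + δ • u) p.2) :=
      S.measurable_integral_shifted_kernel δ u (hm.comp measurable_snd)
    have hB2 : ∀ p : EuclideanSpace ℝ (Fin d) × Z, |∫ y, h y ∂(T (p.1 + δ • u) p.2)| ≤ B :=
      fun p => abs_integral_le_of_abs_le _ (Eventually.of_forall hB)
    have h2 := ih (by omega) hm1 hB1
    have h3 : |∫ p, (∫ y, h y ∂(T (p.1 + δ • u) p.2) - ∫ y, h y ∂(T (s.1 + δ • u) p.2))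
        ∂(dfoInner T ℓ lam η δ τ u s m)| ≤
        2 * B * (L₂ * (η * (d / δ) * G * lam ^ (τ - m) / (1 - lam))) := by
      refine abs_integral_le_of_abs_le _ ?_
      filter_upwards [S.ae_norm_sub_inner_le hlam hlam1 hη hδ hu s (by omega : m ≤ τ)] with p hp
      refine (abs_integral_sub_integral_le_tvDistance _ _ hm hB0 hB).trans ?_
      gcongr
      refine (S.lip_kernel _ _ _).trans ?_
      rw [add_sub_add_right_eq_sub]
      gcongr
    have hm3 : Measurable fun p : EuclideanSpace ℝ (Fin d) × Z =>
        ∫ y, h y ∂(T (s.1 + δ • u) p.2) := hm1.comp measurable_snd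
    rw [integral_sub (integrable_of_abs_le _ hm2 hB2)
      (integrable_of_abs_le _ hm3 (fun p => hB1 p.2))] at h3
    refine (abs_sub_le _ (∫ p, ∫ y, h y ∂(T (s.1 + δ • u) p.2)
      ∂(dfoInner T ℓ lam η δ τ u s m)) _).trans ((add_le_add h3 h2).trans ?_)
    have e : τ - m = (τ - (m + 1)) + 1 := by omega
    rw [e, pow_succ]
    set q := lam ^ (τ - (m + 1))
    have hq : 0 ≤ q := by positivity
    have e2 : 2 * B * (L₂ * (η * (d / δ) * G * (q * lam) / (1 - lam))) +
        2 * B * L₂ * (η * (d / δ) * G * (q * lam) / (1 - lam) ^ 2) =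
        2 * B * L₂ * (η * (d / δ) * G * q * (lam * (2 - lam)) / (1 - lam) ^ 2) := by
      field_simp
      ring
    rw [e2]
    -- With q as above, the kernel error of this step and the inherited error add up to a multiple
    -- of qλ(2-λ)/(1-λ)², so this inequality closes the induction.
    have h4 : lam * (2 - lam) ≤ 1 := by nlinarith [sq_nonneg (1 - lam)]
    exact mul_le_mul_of_nonneg_left (div_le_div_of_nonneg_right
      (mul_le_of_le_one_right (by positivity) h4) (by positivity)) (by positivity)

/-- The expected loss observed at an inner step is close to the performative risk. -/
theorem abs_integral_loss_sub_performativeRisk_le {m : ℕ} (hmτ : m + 1 ≤ τ) :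
    |∫ p, (∫ z, ℓ (p.1 + δ • u) z ∂(T (p.1 + δ • u) p.2)) ∂(dfoInner T ℓ lam η δ τ u s m) -
        performativeRisk ℓ Pi (s.1 + δ • u)| ≤
      (L₀ * G / (1 - lam) + 2 * G ^ 2 * L₂ / (1 - lam) ^ 2) * (η * (d / δ)) +
        2 * G * M * ρ ^ (m + 1) := by
  have hG := S.G_nonneg
  have hL₀ := S.L₀_nonneg
  have hL₂ := S.L₂_nonneg
  have h1 : 0 < 1 - lam := by linarith
  have hT := S.markov
  have hP := S.isProbabilityMeasure_inner lam η δ τ u s m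
  have hP' := S.isProbabilityMeasure_inner lam η δ τ u s (m + 1)
  have hPi := S.prob (s.1 + δ • u)
  have hTm := S.isMarkovKernel_pow (s.1 + δ • u) (m + 1)
  have hpow : ∀ j, lam ^ j ≤ 1 := fun j => pow_le_one₀ hlam hlam1.le
  have hm := S.measurable_loss (s.1 + δ • u)
  have hB := S.bdd_loss (s.1 + δ • u)
  -- Three comparisons are chained: `hdrift` freezes the parameter in the loss, `hfrozen` freezes it
  -- in the kernels, and `hmix` takes the frozen chain, after m + 1 transitions, to its stationary
  -- law.
  have hmix := abs_integral_sub_integral_le_tvDistance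
    ((T (s.1 + δ • u) ^ (m + 1)) s.2) (Pi (s.1 + δ • u)) hm hG hB
  have hmix' := mul_le_mul_of_nonneg_left (S.mixing (s.1 + δ • u) (m + 1) s.2)
    (by positivity : 0 ≤ 2 * G)
  have hfrozen := S.abs_integral_inner_sub_integral_pow_le hlam hlam1 hη hδ hu s hmτ hm hG hB
  have hint := integrable_of_abs_le (dfoInner T ℓ lam η δ τ u s (m + 1))
    (h := fun p => ℓ (s.1 + δ • u) p.2) (by fun_prop) (fun p => hB p.2)
  rw [dfoInner,
    integral_bind (S.measurable_step _ _ _ _) (S.isProbabilityMeasure_step _ _ _ _) hint] at hfrozen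
  simp_rw [S.integral_step _ _ _ _ _ (g := fun p => ℓ (s.1 + δ • u) p.2) (by fun_prop)] at hfrozen
  have hmA : Measurable fun p : EuclideanSpace ℝ (Fin d) × Z =>
      ∫ z, ℓ (p.1 + δ • u) z ∂(T (p.1 + δ • u) p.2) :=
    S.measurable_integral_shifted_kernel δ u (g := fun p z => ℓ (p.1 + δ • u) z)
      (S.measurable_uncurry.comp (f := fun q : (EuclideanSpace ℝ (Fin d) × Z) × Z =>
        (q.1.1 + δ • u, q.2)) (by fun_prop))
  have hmB : Measurable fun p : EuclideanSpace ℝ (Fin d) × Z =>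
      ∫ z, ℓ (s.1 + δ • u) z ∂(T (p.1 + δ • u) p.2) :=
    S.measurable_integral_shifted_kernel δ u (hm.comp measurable_snd)
  have hdrift : |∫ p, (∫ z, ℓ (p.1 + δ • u) z ∂(T (p.1 + δ • u) p.2) -
      ∫ z, ℓ (s.1 + δ • u) z ∂(T (p.1 + δ • u) p.2)) ∂(dfoInner T ℓ lam η δ τ u s m)| ≤
      L₀ * (η * (d / δ) * G * lam ^ (τ - m) / (1 - lam)) := by
    refine abs_integral_le_of_abs_le _ ?_
    filter_upwards [S.ae_norm_sub_inner_le hlam hlam1 hη hδ hu s (by omega : m ≤ τ)] with p hp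
    rw [← integral_sub (integrable_of_abs_le _ (S.measurable_loss _) (S.bdd_loss _))
      (integrable_of_abs_le _ hm hB)]
    refine abs_integral_le_of_abs_le _ (Eventually.of_forall fun z => ?_)
    refine (S.lip_loss _ _ z).trans ?_
    rw [add_sub_add_right_eq_sub]
    gcongr
  rw [integral_sub
    (integrable_of_abs_le _ hmA (fun p =>
      abs_integral_le_of_abs_le _ (Eventually.of_forall (S.bdd_loss _))))
    (integrable_of_abs_le _ hmB (fun p =>
      abs_integral_le_of_abs_le _ (Eventually.of_forall hB)))] at hdrift
  have hd1 : L₀ * (η * (d / δ) * G * lam ^ (τ - m) / (1 - lam)) ≤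
      L₀ * (η * (d / δ) * G * 1 / (1 - lam)) := by
    gcongr
    exact hpow _
  have hd2 : 2 * G * L₂ * (η * (d / δ) * G * lam ^ (τ - (m + 1)) / (1 - lam) ^ 2) ≤
      2 * G * L₂ * (η * (d / δ) * G * 1 / (1 - lam) ^ 2) := by
    gcongr
    exact hpow _
  have e : (L₀ * G / (1 - lam) + 2 * G ^ 2 * L₂ / (1 - lam) ^ 2) * (η * (d / δ)) =
      L₀ * (η * (d / δ) * G * 1 / (1 - lam)) +
        2 * G * L₂ * (η * (d / δ) * G * 1 / (1 - lam) ^ 2) := by ring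
  rw [e]
  rw [abs_le] at hdrift hfrozen hmix ⊢
  unfold performativeRisk
  constructor <;> linarith [hdrift.1, hdrift.2, hfrozen.1, hfrozen.2, hmix.1, hmix.2]

/-- The expected displacement within an epoch, tested against a vector. -/
theorem abs_integral_inner_displacement_le (v : EuclideanSpace ℝ (Fin d)) {m : ℕ} (hmτ : m ≤ τ) :
    |∫ p, inner ℝ v (p.1 - s.1) ∂(dfoInner T ℓ lam η δ τ u s m) +
        η * (d / δ) * (∑ i ∈ Finset.range m, lam ^ (τ - (i + 1))) *
          (performativeRisk ℓ Pi (s.1 + δ • u) * inner ℝ v u)| ≤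
      η * (d / δ) * ‖v‖ * ∑ i ∈ Finset.range m, lam ^ (τ - (i + 1)) *
        ((L₀ * G / (1 - lam) + 2 * G ^ 2 * L₂ / (1 - lam) ^ 2) * (η * (d / δ)) +
          2 * G * M * ρ ^ (i + 1)) := by
  have hG := S.G_nonneg
  have h1 : 0 < 1 - lam := by linarith
  have hT := S.markov
  have hint : ∀ j ≤ τ, Integrable (fun p => inner ℝ v (p.1 - s.1))
      (dfoInner T ℓ lam η δ τ u s j) := by
    intro j hj
    have := S.isProbabilityMeasure_inner lam η δ τ u s j
    refine Integrable.of_bound (by fun_prop)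
      (‖v‖ * (η * (d / δ) * G * lam ^ (τ - j) / (1 - lam))) ?_
    filter_upwards [S.ae_norm_sub_inner_le hlam hlam1 hη hδ hu s hj] with p hp
    refine (norm_inner_le_norm _ _).trans ?_
    gcongr
  induction m with
  | zero => simp [dfoInner, integral_dirac' _ _ (show StronglyMeasurable
      fun p : EuclideanSpace ℝ (Fin d) × Z => inner ℝ v (p.1 - s.1) by fun_prop)]
  | succ m ih =>
    have hP := S.isProbabilityMeasure_inner lam η δ τ u s m
    have h2 := ih (by omega)
    have h3 := S.abs_integral_loss_sub_performativeRisk_le hlam hlam1 hη hδ hu s hmτ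
    have hmA : Measurable fun p : EuclideanSpace ℝ (Fin d) × Z =>
        ∫ z, ℓ (p.1 + δ • u) z ∂(T (p.1 + δ • u) p.2) :=
      S.measurable_integral_shifted_kernel δ u (g := fun p z => ℓ (p.1 + δ • u) z)
        (S.measurable_uncurry.comp (f := fun q : (EuclideanSpace ℝ (Fin d) × Z) × Z =>
          (q.1.1 + δ • u, q.2)) (by fun_prop))
    set q := lam ^ (τ - (m + 1)) with hq
    have hq0 : 0 ≤ q := by positivity
    -- Every increment is a multiple of the same `u`, so its mean is determined by the mean observed
    -- loss alone.
    have e : ∫ p, inner ℝ v (p.1 - s.1) ∂(dfoInner T ℓ lam η δ τ u s (m + 1)) =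
        ∫ p, inner ℝ v (p.1 - s.1) ∂(dfoInner T ℓ lam η δ τ u s m) -
          η * (d / δ) * q * inner ℝ v u *
            ∫ p, (∫ z, ℓ (p.1 + δ • u) z ∂(T (p.1 + δ • u) p.2))
              ∂(dfoInner T ℓ lam η δ τ u s m) := by
      have hint' := hint (m + 1) hmτ
      rw [dfoInner] at hint' ⊢
      rw [integral_bind (S.measurable_step _ _ _ _) (S.isProbabilityMeasure_step _ _ _ _) hint']
      have e1 : ∀ p : EuclideanSpace ℝ (Fin d) × Z,
          ∫ y, inner ℝ v (y.1 - s.1) ∂(dfoStep T ℓ η δ (lam ^ (τ - (m + 1))) u p) =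
          inner ℝ v (p.1 - s.1) - η * (d / δ) * q * inner ℝ v u *
            ∫ z, ℓ (p.1 + δ • u) z ∂(T (p.1 + δ • u) p.2) := by
        intro p
        rw [S.integral_step _ _ _ _ _ (g := fun y => inner ℝ v (y.1 - s.1)) (by fun_prop),
          ← integral_const_mul]
        have e2 : ∀ z', inner ℝ v (p.1 - (η * lam ^ (τ - (m + 1))) •
            (((d : ℝ) / δ * ℓ (p.1 + δ • u) z') • u) - s.1) = inner ℝ v (p.1 - s.1) -
            η * (d / δ) * q * inner ℝ v u * ℓ (p.1 + δ • u) z' := by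
          intro z'
          rw [sub_right_comm, inner_sub_right, real_inner_smul_right, real_inner_smul_right]
          ring
        simp_rw [e2]
        rw [integral_sub (integrable_const _) ((integrable_of_abs_le _ (S.measurable_loss _)
          (S.bdd_loss _)).const_mul _)]
        simp
      simp_rw [e1]
      rw [integral_sub (hint m (by omega)) ((integrable_of_abs_le _ hmA (fun p =>
        abs_integral_le_of_abs_le _ (Eventually.of_forall (S.bdd_loss _)))).const_mul _),
        integral_const_mul]
    rw [e, Finset.sum_range_succ, Finset.sum_range_succ, ← hq]
    set A := ∫ p, (∫ z, ℓ (p.1 + δ • u) z ∂(T (p.1 + δ • u) p.2))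
      ∂(dfoInner T ℓ lam η δ τ u s m)
    set R := performativeRisk ℓ Pi (s.1 + δ • u)
    set err := (L₀ * G / (1 - lam) + 2 * G ^ 2 * L₂ / (1 - lam) ^ 2) * (η * (d / δ)) +
        2 * G * M * ρ ^ (m + 1)
    have h4 : |-(η * (d / δ) * q * inner ℝ v u * (A - R))| ≤ η * (d / δ) * q * ‖v‖ * err := by
      rw [abs_neg, abs_mul, abs_mul, abs_of_nonneg (by positivity : 0 ≤ η * (d / δ) * q)]
      have h5 : |inner ℝ v u| ≤ ‖v‖ := by simpa [hu] using abs_real_inner_le_norm v u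
      gcongr
    refine le_trans (le_of_eq ?_) ((abs_add_le _ _).trans ((add_le_add h2 h4).trans (le_of_eq ?_)))
    · congr 1
      ring
    · ring

end DfoSetting

end Epoch

/-! ### Expected descent over one epoch. -/

section Descent

open Filter

variable {d : ℕ} {Z : Type*} [MeasurableSpace Z]

theorem sum_pow_sub_le {lam : ℝ} (hlam : 0 ≤ lam) (hlam1 : lam < 1) (τ : ℕ) :
    ∑ i ∈ Finset.range τ, lam ^ (τ - (i + 1)) ≤ 1 / (1 - lam) := by
  have e : ∑ i ∈ Finset.range τ, lam ^ (τ - (i + 1)) = ∑ i ∈ Finset.range τ, lam ^ i := by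
    rw [← Finset.sum_range_reflect (fun i => lam ^ i) τ]
    exact Finset.sum_congr rfl fun i hi => by congr 1; omega
  rw [e, one_div, ← tsum_geometric_of_lt_one hlam hlam1]
  exact (summable_geometric_of_lt_one hlam hlam1).sum_le_tsum _ (fun i _ => by positivity)

/-- The last step of an epoch has weight λ^0 = 1, also when λ = 0. This guarantees a full step of
descent. -/
theorem one_le_sum_pow_sub {lam : ℝ} (hlam : 0 ≤ lam) {τ : ℕ} (hτ : 1 ≤ τ) :
    1 ≤ ∑ i ∈ Finset.range τ, lam ^ (τ - (i + 1)) := by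
  have h := Finset.single_le_sum (f := fun i => lam ^ (τ - (i + 1))) (s := Finset.range τ)
    (fun i _ => by positivity) (Finset.mem_range.2 (by omega : τ - 1 < τ))
  have e : τ - (τ - 1 + 1) = 0 := by omega
  simpa [e] using h

/-- Early samples are poorly mixed but have small weight, late ones the reverse. The exponents
always add up to τ. -/
theorem sum_pow_sub_mul_pow_le {lam ρ : ℝ} (hlam : 0 ≤ lam) (hρ : 0 ≤ ρ) (τ : ℕ) :
    ∑ i ∈ Finset.range τ, lam ^ (τ - (i + 1)) * ρ ^ (i + 1) ≤ τ * max ρ lam ^ τ := by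
  have h : ∀ i ∈ Finset.range τ, lam ^ (τ - (i + 1)) * ρ ^ (i + 1) ≤ max ρ lam ^ τ := by
    intro i hi
    have hi' := Finset.mem_range.1 hi
    calc lam ^ (τ - (i + 1)) * ρ ^ (i + 1)
        ≤ max ρ lam ^ (τ - (i + 1)) * max ρ lam ^ (i + 1) := by
          gcongr
          · exact le_max_right _ _
          · exact le_max_left _ _
      _ = max ρ lam ^ τ := by rw [← pow_add]; congr 1; omega
  simpa using Finset.sum_le_sum h

namespace DfoSetting

variable {ℓ : EuclideanSpace ℝ (Fin d) → Z → ℝ} {T : EuclideanSpace ℝ (Fin d) → Kernel Z Z}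
  {Pi : EuclideanSpace ℝ (Fin d) → Measure Z} {L₀ G L₁ L₂ M ρ : ℝ}
  (S : DfoSetting ℓ T Pi L₀ G L₁ L₂ M ρ)

include S

/-- The smoothed risk is definitionally the `ballAverage` of the performative risk, so the smoothing
estimates apply directly. -/
theorem abs_smoothedRisk_le (δ : ℝ) (θ : EuclideanSpace ℝ (Fin d)) :
    |smoothedRisk ℓ Pi δ θ| ≤ G :=
  abs_ballAverage_le S.lipschitzWith_performativeRisk.continuous S.abs_performativeRisk_le δ θ

theorem lipschitzWith_smoothedRisk (δ : ℝ) :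
    LipschitzWith (Real.toNNReal (L₀ + 2 * G * L₁)) (smoothedRisk ℓ Pi δ) :=
  lipschitzWith_ballAverage S.lipschitzWith_performativeRisk δ

theorem lip_nonneg : 0 ≤ L₀ + 2 * G * L₁ := by
  have := S.L₀_nonneg
  have := S.G_nonneg
  have := S.L₁_nonneg
  positivity

theorem norm_gradient_smoothedRisk_le (δ : ℝ) (θ : EuclideanSpace ℝ (Fin d)) :
    ‖gradient (smoothedRisk ℓ Pi δ) θ‖ ≤ L₀ + 2 * G * L₁ := by
  have h := norm_gradient_ballAverage_le S.lipschitzWith_performativeRisk δ θ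
  rwa [Real.coe_toNNReal _ S.lip_nonneg] at h

theorem continuous_gradient_smoothedRisk (hd : 0 < d) {δ : ℝ} (hδ : 0 < δ) :
    Continuous (gradient (smoothedRisk ℓ Pi δ)) :=
  (lipschitzWith_gradient_ballAverage hd S.lipschitzWith_performativeRisk hδ).continuous

theorem integrable_sq_norm_gradient (hd : 0 < d) {δ : ℝ} (hδ : 0 < δ)
    (μ : Measure (EuclideanSpace ℝ (Fin d) × Z)) [IsProbabilityMeasure μ] :
    Integrable (fun s => ‖gradient (smoothedRisk ℓ Pi δ) s.1‖ ^ 2) μ := by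
  have hc := S.continuous_gradient_smoothedRisk hd hδ
  refine integrable_of_abs_le (B := (L₀ + 2 * G * L₁) ^ 2) μ
    (((hc.measurable.comp measurable_fst).norm).pow_const 2) fun s => ?_
  rw [abs_of_nonneg (by positivity)]
  gcongr
  exact S.norm_gradient_smoothedRisk_le δ s.1

theorem integrable_smoothedRisk (δ : ℝ)
    (μ : Measure (EuclideanSpace ℝ (Fin d) × Z)) [IsProbabilityMeasure μ] :
    Integrable (fun s => smoothedRisk ℓ Pi δ s.1) μ :=
  integrable_of_abs_le μ ((S.lipschitzWith_smoothedRisk δ).continuous.measurable.comp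
    measurable_fst) (fun s => S.abs_smoothedRisk_le δ s.1)

theorem measurable_epoch (hd : 0 < d) (lam η δ : ℝ) (τ : ℕ) :
    (Measurable fun s : EuclideanSpace ℝ (Fin d) × Z =>
      (uniformSphere d).bind fun u => dfoInner T ℓ lam η δ τ u s τ) ∧
    ∀ s, IsProbabilityMeasure
      ((uniformSphere d).bind fun u => dfoInner T ℓ lam η δ τ u s τ) := by
  have : NeZero d := ⟨hd.ne'⟩
  have := isProbabilityMeasure_uniformSphere (d := d)
  have hi := measurable_dfoInner T ℓ S.markov S.measurable_kernel S.measurable_uncurry lam η δ τ τ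
  refine ⟨measurable_bind_param _ measurable_const (fun _ => inferInstance) _
    (hi.1.comp measurable_swap), fun s => ?_⟩
  exact isProbabilityMeasure_bind_of_measurable _ _ (hi.1.comp measurable_prodMk_right)
    fun u => hi.2 u s

variable {lam η δ : ℝ} (hlam : 0 ≤ lam) (hlam1 : lam < 1) (hη : 0 ≤ η) (hδ : 0 < δ) {τ : ℕ}

include hlam hlam1 hη hδ

/-- The expected decrease of the smoothed risk over one epoch, given its starting pair. -/
theorem integral_epoch_smoothedRisk_le (hd : 0 < d) (hτ : 1 ≤ τ)
    (s : EuclideanSpace ℝ (Fin d) × Z) :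
    ∫ p, smoothedRisk ℓ Pi δ p.1
        ∂((uniformSphere d).bind fun u => dfoInner T ℓ lam η δ τ u s τ) ≤
      smoothedRisk ℓ Pi δ s.1 - η * ‖gradient (smoothedRisk ℓ Pi δ) s.1‖ ^ 2 +
      η * ((d / δ) * (L₀ + 2 * G * L₁) *
        ((L₀ * G / (1 - lam) + 2 * G ^ 2 * L₂ / (1 - lam) ^ 2) * (η * (d / δ)) * (1 / (1 - lam)) +
          2 * G * M * (τ * max ρ lam ^ τ)) +
        η * (d / δ) ^ 3 * (L₀ + 2 * G * L₁) * (G / (1 - lam)) ^ 2) := by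
  have : NeZero d := ⟨hd.ne'⟩
  have := isProbabilityMeasure_uniformSphere (d := d)
  have hG := S.G_nonneg
  have hM := S.M_nonneg
  have hL₀ := S.L₀_nonneg
  have hL₂ := S.L₂_nonneg
  have hK := S.lip_nonneg
  have h1 : 0 < 1 - lam := by linarith
  have hi := measurable_dfoInner T ℓ S.markov S.measurable_kernel S.measurable_uncurry lam η δ τ τ
  have hmi : Measurable fun u => dfoInner T ℓ lam η δ τ u s τ := hi.1.comp measurable_prodMk_right
  have hpi := fun u => hi.2 u s
  have := (S.measurable_epoch hd lam η δ τ).2 s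
  have hf := S.lipschitzWith_performativeRisk
  set c := (d : ℝ) / δ with hc
  have hc0 : 0 ≤ c := by positivity
  set K := L₀ + 2 * G * L₁ with hKdef
  set H := smoothedRisk ℓ Pi δ with hH
  set v := gradient H s.1 with hv
  set K₁ := L₀ * G / (1 - lam) + 2 * G ^ 2 * L₂ / (1 - lam) ^ 2
  have hK₁ : 0 ≤ K₁ := by positivity
  set W := ∑ i ∈ Finset.range τ, lam ^ (τ - (i + 1)) with hW
  set err := ∑ i ∈ Finset.range τ, lam ^ (τ - (i + 1)) *
    (K₁ * (η * c) + 2 * G * M * ρ ^ (i + 1)) with herr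
  have herr_le : err ≤ K₁ * (η * c) * (1 / (1 - lam)) + 2 * G * M * (τ * max ρ lam ^ τ) := by
    have e : err = K₁ * (η * c) * W +
        2 * G * M * ∑ i ∈ Finset.range τ, lam ^ (τ - (i + 1)) * ρ ^ (i + 1) := by
      rw [herr, hW, Finset.mul_sum, Finset.mul_sum, ← Finset.sum_add_distrib]
      exact Finset.sum_congr rfl fun i _ => by ring
    rw [e]
    gcongr
    · exact sum_pow_sub_le hlam hlam1 τ
    · exact sum_pow_sub_mul_pow_le hlam S.ρ_nonneg τ
  have herr0 : 0 ≤ err := Finset.sum_nonneg fun i _ => by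
    have := S.ρ_nonneg
    positivity
  have hvK : ‖v‖ ≤ K := S.norm_gradient_smoothedRisk_le δ s.1
  -- For a fixed direction: the expansion of `H` at the start of the epoch, with the linear term
  -- from the mean displacement and the quadratic one from the almost sure drift.
  have hpoint : ∀ u, ‖u‖ = 1 → ∫ p, H p.1 ∂(dfoInner T ℓ lam η δ τ u s τ) ≤
      H s.1 + (η * c * ‖v‖ * err + c * K * (η * c * G / (1 - lam)) ^ 2) -
        η * c * W * (performativeRisk ℓ Pi (s.1 + δ • u) * inner ℝ v u) := by
    intro u hu
    have := hpi u
    have hdrift := S.ae_norm_sub_inner_le hlam hlam1 hη hδ hu s le_rfl (m := τ)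
    simp only [Nat.sub_self, pow_zero, mul_one] at hdrift
    have hin : Integrable (fun p => inner ℝ v (p.1 - s.1)) (dfoInner T ℓ lam η δ τ u s τ) := by
      refine Integrable.of_bound (by fun_prop) (‖v‖ * (η * c * G / (1 - lam))) ?_
      filter_upwards [hdrift] with p hp
      refine (norm_inner_le_norm _ _).trans ?_
      gcongr
    have hD := S.abs_integral_inner_displacement_le hlam hlam1 hη hδ hu s v le_rfl (m := τ)
    have hmono : ∫ p, H p.1 ∂(dfoInner T ℓ lam η δ τ u s τ) ≤
        ∫ p, (H s.1 + c * K * (η * c * G / (1 - lam)) ^ 2) + inner ℝ v (p.1 - s.1)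
          ∂(dfoInner T ℓ lam η δ τ u s τ) := by
      refine integral_mono_ae (S.integrable_smoothedRisk δ _)
        ((integrable_const _).add hin) ?_
      filter_upwards [hdrift] with p hp
      have hb := (abs_le.1 (abs_ballAverage_sub_inner_le hd hf hδ s.1 p.1)).2
      rw [Real.coe_toNNReal _ hK] at hb
      have hq : c * K * ‖p.1 - s.1‖ ^ 2 ≤ c * K * (η * c * G / (1 - lam)) ^ 2 := by
        gcongr
      change H p.1 - H s.1 - inner ℝ v (p.1 - s.1) ≤ _ at hb
      linarith
    rw [integral_add (integrable_const _) hin, integral_const] at hmono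
    simp only [probReal_univ, one_smul] at hmono
    have := (abs_le.1 hD).2
    linarith
  have hsm := integrable_smul_uniformSphere hd hf.continuous δ s.1
  have hui : Integrable (fun u => performativeRisk ℓ Pi (s.1 + δ • u) * inner ℝ v u)
      (uniformSphere d) := by
    simpa only [real_inner_smul_right] using hsm.const_inner (𝕜 := ℝ) v
  -- Unbiasedness of the estimator: averaging over directions gives the gradient paired with `v`,
  -- and `v` is that gradient.
  have hgrad : c * ∫ u, performativeRisk ℓ Pi (s.1 + δ • u) * inner ℝ v u ∂(uniformSphere d) =
      ‖v‖ ^ 2 := by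
    rw [← inner_gradient_ballAverage hd hf hδ s.1 v]
    exact real_inner_self_eq_norm_sq v
  rw [integral_bind hmi hpi (S.integrable_smoothedRisk δ _)]
  have hHm : Measurable fun p : EuclideanSpace ℝ (Fin d) × Z => H p.1 :=
    (S.lipschitzWith_smoothedRisk δ).continuous.measurable.comp measurable_fst
  have hmono := integral_mono_ae (μ := uniformSphere d)
    (integrable_of_abs_le _ (measurable_integral_param (g := fun _ p => H p.1) hmi hpi
      (hHm.comp measurable_snd))
      (fun u => abs_integral_le_of_abs_le _
        (Eventually.of_forall fun p => S.abs_smoothedRisk_le δ p.1)))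
    ((integrable_const _).sub (hui.const_mul (η * c * W)))
    ((ae_norm_uniformSphere d).mono hpoint)
  refine hmono.trans ?_
  simp only [_root_.Pi.sub_apply]
  rw [integral_sub (integrable_const _) (hui.const_mul _), integral_const_mul, integral_const]
  simp only [probReal_univ, one_smul]
  have e1 : η * c * W * ∫ u, performativeRisk ℓ Pi (s.1 + δ • u) * inner ℝ v u ∂(uniformSphere d) =
      η * W * ‖v‖ ^ 2 := by
    rw [← hgrad]
    ring
  rw [e1]
  have h2 : η * 1 * ‖v‖ ^ 2 ≤ η * W * ‖v‖ ^ 2 := by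
    gcongr
    exact one_le_sum_pow_sub hlam hτ
  have h3 : η * c * ‖v‖ * err ≤ η * c * K *
      (K₁ * (η * c) * (1 / (1 - lam)) + 2 * G * M * (τ * max ρ lam ^ τ)) := by
    gcongr
  have e2 : c * K * (η * c * G / (1 - lam)) ^ 2 =
      η * (η * c ^ 3 * K * (G / (1 - lam)) ^ 2) := by ring
  rw [e2]
  linarith

/-- One epoch, in expectation: the squared gradient is controlled by the decrease of the
smoothed risk. -/
theorem mul_integral_sq_norm_gradient_le (hd : 0 < d) (hτ : 1 ≤ τ)
    (μ : Measure (EuclideanSpace ℝ (Fin d) × Z)) [IsProbabilityMeasure μ] :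
    η * ∫ s, ‖gradient (smoothedRisk ℓ Pi δ) s.1‖ ^ 2 ∂μ ≤
      ∫ s, smoothedRisk ℓ Pi δ s.1 ∂μ -
      ∫ s, smoothedRisk ℓ Pi δ s.1
        ∂(μ.bind fun s => (uniformSphere d).bind fun u => dfoInner T ℓ lam η δ τ u s τ) +
      η * ((d / δ) * (L₀ + 2 * G * L₁) *
        ((L₀ * G / (1 - lam) + 2 * G ^ 2 * L₂ / (1 - lam) ^ 2) * (η * (d / δ)) * (1 / (1 - lam)) +
          2 * G * M * (τ * max ρ lam ^ τ)) +
        η * (d / δ) ^ 3 * (L₀ + 2 * G * L₁) * (G / (1 - lam)) ^ 2) := by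
  obtain ⟨hm, hp⟩ := S.measurable_epoch hd lam η δ τ
  have := isProbabilityMeasure_bind_of_measurable μ _ hm hp
  rw [integral_bind hm hp (S.integrable_smoothedRisk δ _)]
  have hg := (S.integrable_sq_norm_gradient hd hδ μ).const_mul η
  have hH := S.integrable_smoothedRisk δ μ
  have hHm : Measurable fun p : EuclideanSpace ℝ (Fin d) × Z => smoothedRisk ℓ Pi δ p.1 :=
    (S.lipschitzWith_smoothedRisk δ).continuous.measurable.comp measurable_fst
  have hmono := integral_mono
    (integrable_of_abs_le μ (measurable_integral_param (g := fun _ p => smoothedRisk ℓ Pi δ p.1) hm hp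
      (hHm.comp measurable_snd))
      (fun s => abs_integral_le_of_abs_le _
        (Eventually.of_forall fun p => S.abs_smoothedRisk_le δ p.1)))
    ((hH.sub hg).add (integrable_const _))
    (S.integral_epoch_smoothedRisk_le hlam hlam1 hη hδ hd hτ)
  rw [integral_add' (hH.sub hg) (integrable_const _), integral_sub' hH hg, integral_const_mul,
    integral_const] at hmono
  simp only [probReal_univ, one_smul] at hmono
  linarith

end DfoSetting

end Descent

/-! ### Power sums and decay rates. -/

section Rates

/-- Each of the first n terms of the geometric series is at least q^n. -/
theorem natCast_mul_pow_le {q : ℝ} (hq : 0 ≤ q) (hq1 : q < 1) (n : ℕ) :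
    n * q ^ n ≤ 1 / (1 - q) := by
  have h : ∀ i ∈ Finset.range n, q ^ n ≤ q ^ i := fun i hi =>
    pow_le_pow_of_le_one hq hq1.le (Finset.mem_range.1 hi).le
  have h2 := Finset.sum_le_sum h
  rw [Finset.sum_const, Finset.card_range, nsmul_eq_mul] at h2
  refine h2.trans ?_
  rw [one_div, ← tsum_geometric_of_lt_one hq hq1]
  exact (summable_geometric_of_lt_one hq hq1).sum_le_tsum _ (fun i _ => by positivity)

/-- Epochs of logarithmic length make the mixing error decay polynomially. -/
theorem natCast_mul_pow_le_rpow {r α x : ℝ} (hr : 0 ≤ r) (hr1 : r < 1) (hα : 0 < α) (hα1 : α < 1)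
    (hx : 1 ≤ x) {τ : ℕ} (hτ : 1 ≤ τ) (h : Real.log x / Real.log (1 / r) ≤ τ) :
    τ * r ^ τ ≤ 1 / (1 - r ^ (1 - α)) * x ^ (-α) := by
  have hq1 : r ^ (1 - α) < 1 := Real.rpow_lt_one hr hr1 (by linarith)
  have hq0 : 0 ≤ r ^ (1 - α) := by positivity
  have hx0 : 0 < x := by linarith
  rcases hr.eq_or_lt with rfl | hr0
  -- For r = 0 the logarithmic quotient is 0 and says nothing about τ, but `1 ≤ τ` already makes r^τ
  -- vanish.
  · rw [zero_pow (by omega), mul_zero]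
    have : 0 < 1 - (0 : ℝ) ^ (1 - α) := by linarith
    positivity
  · have hlog : 0 < Real.log (1 / r) := Real.log_pos (by rw [lt_div_iff₀ hr0]; linarith)
    have h1 : r ^ τ ≤ x⁻¹ := by
      rw [← Real.log_le_log_iff (by positivity) (by positivity), Real.log_pow, Real.log_inv]
      rw [div_le_iff₀ hlog, one_div, Real.log_inv] at h
      linarith
    -- The first factor absorbs the prefactor τ; the second is at most x^(-α), since r^τ ≤ 1/x.
    have e : r ^ τ = (r ^ (1 - α)) ^ τ * (r ^ τ) ^ α := by
      rw [← Real.rpow_natCast (r ^ (1 - α)), ← Real.rpow_natCast r, ← Real.rpow_mul hr,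
        ← Real.rpow_mul hr, ← Real.rpow_add hr0]
      congr 1
      ring
    rw [e, ← mul_assoc, Real.rpow_neg hx0.le, ← Real.inv_rpow hx0.le]
    have h3 : 0 ≤ 1 / (1 - r ^ (1 - α)) := by
      have : 0 < 1 - r ^ (1 - α) := by linarith
      positivity
    gcongr
    exact natCast_mul_pow_le hq0 hq1 τ

theorem sum_rpow_neg_le {a : ℝ} (ha : 0 ≤ a) (ha1 : a < 1) (N : ℕ) :
    ∑ k ∈ Finset.range (N + 1), (1 + (k : ℝ)) ^ (-a) ≤ 1 / (1 - a) * (1 + (N : ℝ)) ^ (1 - a) := by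
  have h1 : 0 < 1 - a := by linarith
  induction N with
  | zero =>
    simp only [zero_add, Finset.sum_range_one, Nat.cast_zero, add_zero, Real.one_rpow, mul_one]
    rw [le_div_iff₀ h1]
    linarith
  | succ N ih =>
    rw [Finset.sum_range_succ]
    refine (add_le_add_left ih _).trans ?_
    push_cast
    have hy : (0 : ℝ) < 1 + (N + 1) := by positivity
    set y : ℝ := 1 + (N + 1) with hydef
    have hy2 : 1 ≤ y := by simp only [hydef]; linarith [(Nat.cast_nonneg N : (0 : ℝ) ≤ N)]
    -- Bernoulli's inequality, in place of an integral comparison: y^(1-a) - (y-1)^(1-a) ≥ (1-a)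
    -- y^(-a).
    have hb := rpow_one_add_le_one_add_mul_self (s := -(1 / y)) (p := 1 - a)
      (by rw [neg_le_neg_iff, div_le_one hy]; exact hy2) h1.le (by linarith)
    have e : (1 : ℝ) + N = y * (1 + -(1 / y)) := by
      rw [mul_add, mul_neg, mul_one_div_cancel hy.ne', hydef]
      ring
    have hnn : 0 ≤ 1 + -(1 / y) := by
      have : 1 / y ≤ 1 := by rw [div_le_one hy]; exact hy2
      linarith
    have e2 : y ^ (-a) = y ^ (1 - a) / y := by
      rw [← Real.rpow_sub_one hy.ne']
      congr 1
      ring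
    rw [e, Real.mul_rpow hy.le hnn, e2]
    have h3 := mul_le_mul_of_nonneg_left hb (by positivity : 0 ≤ 1 / (1 - a) * y ^ (1 - a))
    have e3 : 1 / (1 - a) * y ^ (1 - a) * (1 + (1 - a) * -(1 / y)) =
        1 / (1 - a) * y ^ (1 - a) - y ^ (1 - a) / y := by
      field_simp
      ring
    rw [e3, mul_assoc] at h3
    linarith

/-- Summation by parts for a bounded sequence, with a decreasing positive weight. -/
theorem sum_sub_div_le {Φ η : ℕ → ℝ} {B : ℝ} (hΦ : ∀ k, 0 ≤ Φ k) (hΦB : ∀ k, Φ k ≤ B)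
    (hη : ∀ k, 0 < η k) (hanti : Antitone η) (N : ℕ) :
    ∑ k ∈ Finset.range (N + 1), (Φ k - Φ (k + 1)) / η k ≤ B / η N := by
  -- Keeping `- Φ (N + 1)` makes the induction close: the nonnegative numerator lets η N be replaced
  -- by the smaller η (N + 1).
  have h : ∑ k ∈ Finset.range (N + 1), (Φ k - Φ (k + 1)) / η k ≤ (B - Φ (N + 1)) / η N := by
    induction N with
    | zero =>
      rw [zero_add, Finset.sum_range_one]
      exact div_le_div_of_nonneg_right (by linarith [hΦB 0]) (hη 0).le
    | succ N ih =>
      rw [Finset.sum_range_succ]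
      have h1 : (B - Φ (N + 1)) / η N ≤ (B - Φ (N + 1)) / η (N + 1) :=
        div_le_div_of_nonneg_left (by linarith [hΦB (N + 1)]) (hη _) (hanti N.le_succ)
      refine (add_le_add_left (ih.trans h1) _).trans (le_of_eq ?_)
      rw [← add_div]
      congr 1
      ring
  exact h.trans (div_le_div_of_nonneg_right (by linarith [hΦ (N + 1)]) (hη N).le)

theorem one_div_mul_rpow_le {N : ℕ} (hN : 0 < N) {a b c : ℝ} (hb : 0 ≤ b)
    (hcb : c ≤ b) (ha : a = 1 - b) :
    1 / (1 + (N : ℝ)) * (1 + (N : ℝ)) ^ a ≤ (N : ℝ) ^ (-c) := by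
  have hN1 : (1 : ℝ) ≤ N := by exact_mod_cast hN
  have h0 : (0 : ℝ) < 1 + N := by positivity
  have e : 1 / (1 + (N : ℝ)) * (1 + (N : ℝ)) ^ a = (1 + (N : ℝ)) ^ (-b) := by
    rw [ha, one_div, ← Real.rpow_neg_one, ← Real.rpow_add h0]
    congr 1
    ring
  rw [e]
  exact (Real.rpow_le_rpow_of_nonpos (by positivity) (by linarith) (by linarith)).trans
    (Real.rpow_le_rpow_of_exponent_le hN1 (by linarith))

end Rates

/-! ### Summation over the epochs and the final bounds. -/

section Main

variable {d : ℕ} {Z : Type*} [MeasurableSpace Z] {ℓ : EuclideanSpace ℝ (Fin d) → Z → ℝ}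
  {T : EuclideanSpace ℝ (Fin d) → Kernel Z Z} {Pi : EuclideanSpace ℝ (Fin d) → Measure Z}
  {L₀ G L₁ L₂ M ρ lam η₀ α β : ℝ}

/-- The error of one epoch of the algorithm, for the step sizes and radii of the schedule. -/
theorem epoch_error_le {K K₁ D x t : ℝ} (hx : 1 ≤ x) (hK : 0 ≤ K) (hK₁ : 0 ≤ K₁)
    (hGM : 0 ≤ G * M) (hlam1 : lam < 1) (hη₀ : 0 ≤ η₀) (hβ : 0 ≤ β) (hD : 0 ≤ D)
    (ht : t ≤ D * x ^ (-α)) :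
    x ^ β * K * (K₁ * (η₀ * x ^ (-α) * x ^ β) * (1 / (1 - lam)) + 2 * G * M * t) +
        η₀ * x ^ (-α) * (x ^ β) ^ 3 * K * (G / (1 - lam)) ^ 2 ≤
      (K * (K₁ * η₀ * (1 / (1 - lam)) + 2 * (G * M) * D) + η₀ * K * (G / (1 - lam)) ^ 2) *
        x ^ (-(α - 3 * β)) := by
  have hx0 : 0 < x := by linarith
  have h1 : 0 < 1 - lam := by linarith
  -- Here x stands for 1 + k and x^β for d/δ_k. The curvature term fixes the exponent α - 3β; the
  -- other two decay at least as fast, since `1 ≤ x` and `0 ≤ β`.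
  have e3 : x ^ (-α) * (x ^ β) ^ 3 = x ^ (-(α - 3 * β)) := by
    rw [← Real.rpow_natCast (x ^ β), ← Real.rpow_mul hx0.le, ← Real.rpow_add hx0]
    congr 1
    push_cast
    ring
  have e2 : x ^ (-α) * x ^ β * x ^ β ≤ x ^ (-(α - 3 * β)) := by
    rw [← Real.rpow_add hx0, ← Real.rpow_add hx0]
    exact Real.rpow_le_rpow_of_exponent_le hx (by linarith)
  have e1 : x ^ β * t ≤ D * x ^ (-(α - 3 * β)) := by
    refine (mul_le_mul_of_nonneg_left ht (by positivity)).trans ?_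
    have : x ^ β * x ^ (-α) ≤ x ^ (-(α - 3 * β)) := by
      rw [← Real.rpow_add hx0]
      exact Real.rpow_le_rpow_of_exponent_le hx (by linarith)
    calc x ^ β * (D * x ^ (-α)) = D * (x ^ β * x ^ (-α)) := by ring
      _ ≤ _ := by gcongr
  set y := x ^ (-(α - 3 * β))
  calc x ^ β * K * (K₁ * (η₀ * x ^ (-α) * x ^ β) * (1 / (1 - lam)) + 2 * G * M * t) +
        η₀ * x ^ (-α) * (x ^ β) ^ 3 * K * (G / (1 - lam)) ^ 2
      = K * (K₁ * η₀ * (1 / (1 - lam)) * (x ^ (-α) * x ^ β * x ^ β) + 2 * (G * M) * (x ^ β * t)) +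
        η₀ * K * (G / (1 - lam)) ^ 2 * (x ^ (-α) * (x ^ β) ^ 3) := by ring
    _ ≤ K * (K₁ * η₀ * (1 / (1 - lam)) * y + 2 * (G * M) * (D * y)) +
        η₀ * K * (G / (1 - lam)) ^ 2 * y := by
      rw [e3]
      gcongr
    _ = _ := by ring

/-- The constant of the stationarity bound. -/
def stationarityConstant (d : ℕ) (L₀ G L₁ L₂ M ρ lam η₀ α β : ℝ) : ℝ :=
  (2 * G + (L₀ + 2 * G * L₁) * d) / η₀ +
    ((L₀ + 2 * G * L₁) * ((L₀ * G / (1 - lam) + 2 * G ^ 2 * L₂ / (1 - lam) ^ 2) * η₀ *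
      (1 / (1 - lam)) + 2 * (G * M) * (1 / (1 - max ρ lam ^ (1 - α)))) +
      η₀ * (L₀ + 2 * G * L₁) * (G / (1 - lam)) ^ 2) * (1 / (1 - (α - 3 * β)))

namespace DfoSetting

variable (S : DfoSetting ℓ T Pi L₀ G L₁ L₂ M ρ)

include S

theorem abs_smoothedRisk_sub_performativeRisk_le {δ : ℝ} (hδ : 0 ≤ δ)
    (θ : EuclideanSpace ℝ (Fin d)) :
    |smoothedRisk ℓ Pi δ θ - performativeRisk ℓ Pi θ| ≤ (L₀ + 2 * G * L₁) * δ := by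
  have h := abs_ballAverage_sub_self_le S.lipschitzWith_performativeRisk hδ θ
  rwa [Real.coe_toNNReal _ S.lip_nonneg] at h

/-- The averaged bias of the smoothed risks. -/
theorem average_bias_le (hβ : 0 ≤ β) (hβ1 : β < 1) {δ : ℕ → ℝ}
    (hδ : ∀ k : ℕ, δ k = (d : ℝ) * (1 + (k : ℝ)) ^ (-β)) {N : ℕ} (hN : 0 < N)
    (θ : EuclideanSpace ℝ (Fin d)) :
    1 / (1 + (N : ℝ)) * ∑ k ∈ Finset.range (N + 1),
        |smoothedRisk ℓ Pi (δ k) θ - performativeRisk ℓ Pi θ| ≤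
      (L₀ + 2 * G * L₁) * d * (1 / (1 - β)) * (N : ℝ) ^ (-β) := by
  have hK := S.lip_nonneg
  have h1 : 0 < 1 - β := by linarith
  have hsum : ∑ k ∈ Finset.range (N + 1), |smoothedRisk ℓ Pi (δ k) θ - performativeRisk ℓ Pi θ| ≤
      (L₀ + 2 * G * L₁) * d * (1 / (1 - β) * (1 + (N : ℝ)) ^ (1 - β)) := by
    refine le_trans ?_ (mul_le_mul_of_nonneg_left (sum_rpow_neg_le hβ hβ1 N)
      (by positivity : 0 ≤ (L₀ + 2 * G * L₁) * d))
    rw [Finset.mul_sum]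
    refine Finset.sum_le_sum fun k _ => ?_
    have hk : 0 ≤ δ k := by rw [hδ]; positivity
    rw [mul_assoc, ← hδ]
    exact S.abs_smoothedRisk_sub_performativeRisk_le hk θ
  have h2 := one_div_mul_rpow_le hN hβ le_rfl (rfl : 1 - β = 1 - β)
  calc _ ≤ 1 / (1 + (N : ℝ)) *
        ((L₀ + 2 * G * L₁) * d * (1 / (1 - β) * (1 + (N : ℝ)) ^ (1 - β))) := by gcongr
    _ = (L₀ + 2 * G * L₁) * d * (1 / (1 - β)) *
        (1 / (1 + (N : ℝ)) * (1 + (N : ℝ)) ^ (1 - β)) := by ring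
    _ ≤ _ := by gcongr

/-- The averaged squared gradient norm along the iterates. -/
theorem average_sq_norm_gradient_le (hd : 0 < d) (hρ1 : ρ < 1) (hlam : 0 ≤ lam) (hlam1 : lam < 1)
    (hη₀ : 0 < η₀) (hβ : 0 < β) (hβα : 3 * β < α) (hα : α < 1)
    {μ₀ : Measure (EuclideanSpace ℝ (Fin d) × Z)} {η δ : ℕ → ℝ} {τ : ℕ → ℕ}
    (hμ : ∀ k, IsProbabilityMeasure (dfoLaw T ℓ lam η δ τ μ₀ k))
    (hη : ∀ k : ℕ, η k = η₀ * (1 + (k : ℝ)) ^ (-α))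
    (hδ : ∀ k : ℕ, δ k = (d : ℝ) * (1 + (k : ℝ)) ^ (-β))
    (hτ : ∀ k : ℕ, 1 ≤ τ k)
    (hτlog : ∀ k : ℕ, Real.log (1 + (k : ℝ)) / Real.log (1 / max ρ lam) ≤ (τ k : ℝ))
    {N : ℕ} (hN : 0 < N) :
    1 / (1 + (N : ℝ)) * ∑ k ∈ Finset.range (N + 1),
        ∫ s, ‖gradient (smoothedRisk ℓ Pi (δ k)) s.1‖ ^ 2 ∂(dfoLaw T ℓ lam η δ τ μ₀ k) ≤
      stationarityConstant d L₀ G L₁ L₂ M ρ lam η₀ α β * (N : ℝ) ^ (-min (1 - α) (α - 3 * β)) := by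
  have hK := S.lip_nonneg
  have hG := S.G_nonneg
  have hM := S.M_nonneg
  have hL₀ := S.L₀_nonneg
  have hL₂ := S.L₂_nonneg
  have h1 : 0 < 1 - lam := by linarith
  have hx : ∀ k : ℕ, (1 : ℝ) ≤ 1 + k := fun k => by linarith [(Nat.cast_nonneg k : (0 : ℝ) ≤ k)]
  have hr0 : 0 ≤ max ρ lam := le_max_of_le_right hlam
  have hr1 : max ρ lam < 1 := max_lt hρ1 hlam1
  have hD : 0 ≤ 1 / (1 - max ρ lam ^ (1 - α)) := by
    have : max ρ lam ^ (1 - α) < 1 := Real.rpow_lt_one hr0 hr1 (by linarith)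
    have : 0 < 1 - max ρ lam ^ (1 - α) := by linarith
    positivity
  have hd' : (0 : ℝ) < d := by exact_mod_cast hd
  have hη0 : ∀ k, 0 < η k := fun k => by rw [hη]; have := hx k; positivity
  have hδ0 : ∀ k, 0 < δ k := fun k => by rw [hδ]; have := hx k; positivity
  have hηa : Antitone η := fun i j hij => by
    rw [hη, hη]
    have : (1 : ℝ) + i ≤ 1 + j := by gcongr
    exact mul_le_mul_of_nonneg_left (Real.rpow_le_rpow_of_nonpos (by positivity) this (by linarith))
      hη₀.le
  have hδa : Antitone δ := fun i j hij => by
    rw [hδ, hδ]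
    have : (1 : ℝ) + i ≤ 1 + j := by gcongr
    exact mul_le_mul_of_nonneg_left (Real.rpow_le_rpow_of_nonpos (by positivity) this (by linarith))
      hd'.le
  have hδd : ∀ k, δ k ≤ d := fun k => by
    have h := hδa k.zero_le
    rw [hδ 0] at h
    simpa using h
  unfold stationarityConstant
  set K := L₀ + 2 * G * L₁
  set K₁ := L₀ * G / (1 - lam) + 2 * G ^ 2 * L₂ / (1 - lam) ^ 2
  have hK₁ : 0 ≤ K₁ := by positivity
  set D := 1 / (1 - max ρ lam ^ (1 - α))
  set R := K * (K₁ * η₀ * (1 / (1 - lam)) + 2 * (G * M) * D) + η₀ * K * (G / (1 - lam)) ^ 2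
  have hR : 0 ≤ R := by positivity
  -- The term `K * δ k` pays for the change of radius from one epoch to the next, as the radii
  -- decrease; the constant `G` makes the potential nonnegative.
  let Φ : ℕ → ℝ := fun k =>
    ∫ s, smoothedRisk ℓ Pi (δ k) s.1 ∂(dfoLaw T ℓ lam η δ τ μ₀ k) + K * δ k + G
  have habs : ∀ k, |∫ s, smoothedRisk ℓ Pi (δ k) s.1 ∂(dfoLaw T ℓ lam η δ τ μ₀ k)| ≤ G := fun k =>
    abs_integral_le_of_abs_le _ (Filter.Eventually.of_forall fun s => S.abs_smoothedRisk_le _ s.1)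
  have hΦ0 : ∀ k, 0 ≤ Φ k := fun k => by
    have := (abs_le.1 (habs k)).1
    have := mul_nonneg hK (hδ0 k).le
    simp only [Φ]
    linarith
  have hΦB : ∀ k, Φ k ≤ 2 * G + K * d := fun k => by
    have := (abs_le.1 (habs k)).2
    have := mul_le_mul_of_nonneg_left (hδd k) hK
    simp only [Φ]
    linarith
  have hstep : ∀ k, ∫ s, ‖gradient (smoothedRisk ℓ Pi (δ k)) s.1‖ ^ 2
      ∂(dfoLaw T ℓ lam η δ τ μ₀ k) ≤
      (Φ k - Φ (k + 1)) / η k + R * (1 + (k : ℝ)) ^ (-(α - 3 * β)) := by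
    intro k
    have hdec := S.mul_integral_sq_norm_gradient_le hlam hlam1 (hη0 k).le (hδ0 k) hd (hτ k)
      (dfoLaw T ℓ lam η δ τ μ₀ k)
    have hlaw : (dfoLaw T ℓ lam η δ τ μ₀ k).bind (fun s => (uniformSphere d).bind fun u =>
        dfoInner T ℓ lam (η k) (δ k) (τ k) u s (τ k)) = dfoLaw T ℓ lam η δ τ μ₀ (k + 1) := rfl
    rw [hlaw] at hdec
    have hc : (d : ℝ) / δ k = (1 + (k : ℝ)) ^ β := by
      have := hx k
      rw [hδ, Real.rpow_neg (by positivity)]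
      field_simp
    have herr := epoch_error_le (G := G) (M := M) (lam := lam) (η₀ := η₀) (β := β) (hx k) hK hK₁
      (by positivity) hlam1 hη₀.le hβ.le hD
      (natCast_mul_pow_le_rpow hr0 hr1 (by linarith) hα (hx k) (hτ k) (hτlog k))
    rw [← hη k, ← hc] at herr
    have hdrift : ∫ s, smoothedRisk ℓ Pi (δ (k + 1)) s.1 ∂(dfoLaw T ℓ lam η δ τ μ₀ (k + 1)) ≤
        ∫ s, smoothedRisk ℓ Pi (δ k) s.1 ∂(dfoLaw T ℓ lam η δ τ μ₀ (k + 1)) +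
          K * (δ k - δ (k + 1)) := by
      rw [← sub_le_iff_le_add', ← integral_sub (S.integrable_smoothedRisk _ _)
        (S.integrable_smoothedRisk _ _)]
      refine (le_abs_self _).trans (abs_integral_le_of_abs_le _
        (Filter.Eventually.of_forall fun s => ?_))
      have h := abs_ballAverage_sub_ballAverage_le S.lipschitzWith_performativeRisk
        (δ (k + 1)) (δ k) s.1
      rw [Real.coe_toNNReal _ hK, abs_sub_comm (δ (k + 1)),
        abs_of_nonneg (sub_nonneg.2 (hδa k.le_succ))] at h
      exact h
    have herr' := mul_le_mul_of_nonneg_left herr (hη0 k).le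
    rw [← sub_le_iff_le_add, le_div_iff₀ (hη0 k)]
    simp only [Φ]
    linarith
  have hsum : ∑ k ∈ Finset.range (N + 1), ∫ s, ‖gradient (smoothedRisk ℓ Pi (δ k)) s.1‖ ^ 2
      ∂(dfoLaw T ℓ lam η δ τ μ₀ k) ≤ (2 * G + K * d) / η₀ * (1 + (N : ℝ)) ^ α +
        R * (1 / (1 - (α - 3 * β)) * (1 + (N : ℝ)) ^ (1 - (α - 3 * β))) := by
    refine (Finset.sum_le_sum fun k _ => hstep k).trans ?_
    rw [Finset.sum_add_distrib, ← Finset.mul_sum]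
    -- The telescoped part costs the potential bound over η N, that is, a multiple of (1 + N)^α;
    -- this becomes the rate 1 - α.
    refine add_le_add ((sum_sub_div_le hΦ0 hΦB hη0 hηa N).trans (le_of_eq ?_))
      (mul_le_mul_of_nonneg_left (sum_rpow_neg_le (by linarith) (by linarith) N) hR)
    have := hx N
    rw [hη, Real.rpow_neg (by positivity)]
    field_simp
  have r1 := one_div_mul_rpow_le hN (a := α) (b := 1 - α) (c := min (1 - α) (α - 3 * β))
    (by linarith) (min_le_left _ _)
    (by ring)
  have r2 := one_div_mul_rpow_le hN (a := 1 - (α - 3 * β)) (b := α - 3 * β)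
    (c := min (1 - α) (α - 3 * β)) (by linarith)
    (min_le_right _ _) rfl
  have hq : 0 ≤ 1 / (1 - (α - 3 * β)) := by
    have : 0 < 1 - (α - 3 * β) := by linarith
    positivity
  refine (mul_le_mul_of_nonneg_left hsum (by positivity)).trans ?_
  calc _ = (2 * G + K * d) / η₀ * (1 / (1 + (N : ℝ)) * (1 + (N : ℝ)) ^ α) +
        R * (1 / (1 - (α - 3 * β))) *
          (1 / (1 + (N : ℝ)) * (1 + (N : ℝ)) ^ (1 - (α - 3 * β))) := by ring
    _ ≤ (2 * G + K * d) / η₀ * (N : ℝ) ^ (-min (1 - α) (α - 3 * β)) +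
        R * (1 / (1 - (α - 3 * β))) * (N : ℝ) ^ (-min (1 - α) (α - 3 * β)) := by
      gcongr
    _ = _ := by ring

end DfoSetting

end Main

end

theorem mainTheorem3 (d : ℕ) (hd : 0 < d)
    (L₀ G L₁ L₂ M ρ lam η₀ α β : ℝ)
    (hL₀ : 0 < L₀) (hG : 0 < G) (hL₁ : 0 < L₁) (hL₂ : 0 ≤ L₂) (hM : 0 ≤ M)
    (hρ : 0 ≤ ρ) (hρ1 : ρ < 1) (hlam : 0 ≤ lam) (hlam1 : lam < 1) (hη₀ : 0 < η₀)
    (hβ : 0 < 3 * β) (hβα : 3 * β < α) (hα : α < 1) :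
    ∃ (C : ℝ) (t₄ : ℕ),
      ∀ (Z : Type*) [MeasurableSpace Z]
        (ℓ : EuclideanSpace ℝ (Fin d) → Z → ℝ)
        (T : EuclideanSpace ℝ (Fin d) → Kernel Z Z)
        (Pi : EuclideanSpace ℝ (Fin d) → Measure Z)
        (μ₀ : Measure (EuclideanSpace ℝ (Fin d) × Z))
        (η δ : ℕ → ℝ) (τ : ℕ → ℕ),
        (∀ θ, Measurable (ℓ θ)) →
        (∀ θ, IsMarkovKernel (T θ)) →
        (∀ θ, IsProbabilityMeasure (Pi θ)) →
        (∀ θ, Kernel.Invariant (T θ) (Pi θ)) →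
        IsProbabilityMeasure μ₀ →
        -- Lipschitz loss
        (∀ θ₁ θ₂ z, |ℓ θ₁ z - ℓ θ₂ z| ≤ L₀ * ‖θ₁ - θ₂‖) →
        -- bounded loss
        (∀ θ z, |ℓ θ z| ≤ G) →
        -- Lipschitz distribution map
        (∀ θ₁ θ₂, tvDistance (Pi θ₁) (Pi θ₂) ≤ L₁ * ‖θ₁ - θ₂‖) →
        -- geometric mixing
        (∀ θ (k : ℕ) z, tvDistance ((T θ ^ k) z) (Pi θ) ≤ M * ρ ^ k) →
        -- smoothness of the Markov kernel
        (∀ θ₁ θ₂ z, tvDistance (T θ₁ z) (T θ₂ z) ≤ L₂ * ‖θ₁ - θ₂‖) →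
        -- step sizes, query radii and epoch lengths
        (∀ k : ℕ, η k = η₀ * (1 + (k : ℝ)) ^ (-α)) →
        (∀ k : ℕ, δ k = (d : ℝ) * (1 + (k : ℝ)) ^ (-β)) →
        (∀ k : ℕ, 1 ≤ τ k) →
        (∀ k : ℕ, Real.log (1 + (k : ℝ)) / Real.log (1 / max ρ lam) ≤ (τ k : ℝ)) →
        (∀ k : ℕ, Differentiable ℝ (smoothedRisk ℓ Pi (δ k))) ∧
        (∀ k : ℕ, Integrable (fun s => ‖gradient (smoothedRisk ℓ Pi (δ k)) s.1‖ ^ 2)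
          (dfoLaw T ℓ lam η δ τ μ₀ k)) ∧
        (∀ N : ℕ, t₄ ≤ N →
          1 / (1 + (N : ℝ)) * ∑ k ∈ Finset.range (N + 1),
              ∫ s, ‖gradient (smoothedRisk ℓ Pi (δ k)) s.1‖ ^ 2 ∂(dfoLaw T ℓ lam η δ τ μ₀ k)
            ≤ C * (N : ℝ) ^ (-min (1 - α) (α - 3 * β))) ∧
        (∀ N : ℕ, 0 < N → ∀ θ : EuclideanSpace ℝ (Fin d),
          1 / (1 + (N : ℝ)) * ∑ k ∈ Finset.range (N + 1),
              |smoothedRisk ℓ Pi (δ k) θ - performativeRisk ℓ Pi θ|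
            ≤ C * (N : ℝ) ^ (-β)) := by
  -- One constant serves both bounds. The threshold 1 excludes N = 0, where the real power of 0 with
  -- nonzero exponent is 0.
  refine ⟨max (stationarityConstant d L₀ G L₁ L₂ M ρ lam η₀ α β)
    ((L₀ + 2 * G * L₁) * d * (1 / (1 - β))), 1, ?_⟩
  intro Z _ ℓ T Pi μ₀ η δ τ hm hT hPi _ hμ₀ hlip hbdd hlipPi hmix hlipT hη hδ hτ hτlog
  have S : DfoSetting ℓ T Pi L₀ G L₁ L₂ M ρ :=
    { measurable_loss := hm
      markov := hT
      prob := hPi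
      lip_loss := hlip
      bdd_loss := hbdd
      lip_stationary := hlipPi
      mixing := hmix
      lip_kernel := hlipT
      L₀_nonneg := hL₀.le
      G_nonneg := hG.le
      L₁_nonneg := hL₁.le
      L₂_nonneg := hL₂
      M_nonneg := hM
      ρ_nonneg := hρ }
  have hμ := isProbabilityMeasure_dfoLaw hd T ℓ hT hm L₀ L₂ hlip hlipT lam η δ τ μ₀ hμ₀
  have hδ0 : ∀ k, 0 < δ k := fun k => by
    have : (0 : ℝ) < d := by exact_mod_cast hd
    rw [hδ]
    positivity
  refine ⟨fun k θ => ?_, fun k => ?_, fun N hN => ?_, fun N hN θ => ?_⟩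
  · exact (hasGradientAt_ballAverage hd S.lipschitzWith_performativeRisk (hδ0 k) θ).differentiableAt
  · exact S.integrable_sq_norm_gradient hd (hδ0 k) _
  · exact (S.average_sq_norm_gradient_le hd hρ1 hlam hlam1 hη₀ (by linarith) hβα hα hμ hη hδ hτ hτlog
      hN).trans (mul_le_mul_of_nonneg_right (le_max_left _ _) (by positivity))
  · exact (S.average_bias_le (by linarith) (by linarith) hδ hN θ).trans
      (mul_le_mul_of_nonneg_right (le_max_right _ _) (by positivity))
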